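/- Let $M=T^{4m}=E/\Gamma$ be a flat hyperkähler torus: $E$ is a real Euclidean vector space of dimension $4m$ with orthogonal linear complex structures $I$, $J$, $K=IJ=-JI$, $\Gamma\subset E$ is a lattice of full rank, and $M$ carries the induced constant structures $g, I, J, K$. For ${\bf a}=(a,b,c)\in S^2$ put $I_{\bf a}=aI+bJ+cK$, and let $Z=M\times S^2$ with $\mathcal I_{(x,{\bf a})}=(I_{\bf a},I_{S^2})$, where $I_{S^2}v={\bf a}\times v$ on $T_{\bf a}S^2={\bf a}^\perp$. Let $\lambda=\frac{c+ib}{1-a}$ be the stereographic coordinate on $S^2\cong\mathbb{CP}^1$, so that $I,J,K,-I$ correspond to $\lambda=\infty,\,i,\,1,\,0$. Let $\omega_I(X,Y)=g(IX,Y)$, let $\omega_I^{-1}:T^*M\to TM$ be defined by $\omega_I(\omega_I^{-1}\alpha,Y)=\alpha(Y)$, and let $P_I(\alpha,\beta)=\beta(\omega_I^{-1}\alpha)$ be the bivector on $M$ dual to $\omega_I$. With $s_{\bf a}:M\to Z$, $s_{\bf a}(x)=(x,{\bf a})$, let $\mathcal P_{(x,{\bf a})}=\big((s_{\bf a})_*P_I\big)^{(2,0)}$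 be the $(2,0)$-part with respect to $\mathcal I$. Then $\mathcal I$ is an integrable complex structure on $Z$, and $\mathcal P$ is a holomorphic Poisson structure on $(Z,\mathcal I)$. Moreover, $\frac1\lambda\mathcal P$, which is defined where $\lambda\ne0$, and $\lambda\mathcal P$, which is defined where $\lambda\neq\infty$, extend to holomorphic Poisson structures on all of $Z$. Here a holomorphic Poisson structure is a smooth complex bivector field $P$ of type $(2,0)$ with $[P,P]=0$ whose components $P^{jk}=P(dz^j,dz^k)$ in all local holomorphic coordinates are holomorphic. -/

import Mathlib

open scoped Manifold ContDiff InnerProductSpace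

noncomputable section

/-! ### Complex bivectors on a real vector space

The complexified dual of a real vector space `V` is `V →L[ℝ] ℂ`.  For finite dimensional `V`, an
element of `Λ²(V ⊗ ℂ)` is the same as an alternating `ℂ`-bilinear form on it. -/

/-- Complex bivectors on a (finite dimensional) real vector space `V`, viewed as alternating
`ℂ`-bilinear forms `(α, β) ↦ P(α, β)` on complex valued covectors. -/
abbrev CBivector (V : Type*) [AddCommGroup V] [Module ℝ V] [TopologicalSpace V] : Type _ :=
  (V →L[ℝ] ℂ) [⋀^Fin 2]→ₗ[ℂ] ℂ

/-- Pull-back of complex covectors, `α ↦ α ∘ L`. -/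
def covectorPullback {V W : Type*} [AddCommGroup V] [Module ℝ V] [TopologicalSpace V]
    [AddCommGroup W] [Module ℝ W] [TopologicalSpace W] (L : V →L[ℝ] W) :
    (W →L[ℝ] ℂ) →ₗ[ℂ] (V →L[ℝ] ℂ) where
  toFun α := α.comp L
  map_add' _ _ := rfl
  map_smul' _ _ := rfl

@[simp]
theorem covectorPullback_apply {V W : Type*} [AddCommGroup V] [Module ℝ V] [TopologicalSpace V]
    [AddCommGroup W] [Module ℝ W] [TopologicalSpace W] (L : V →L[ℝ] W) (α : W →L[ℝ] ℂ) (v : V) :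
    covectorPullback L α v = α (L v) := rfl

/-- Push-forward of complex bivectors, `(L_* P)(α, β) = P(α ∘ L, β ∘ L)`. -/
def CBivector.pushforward {V W : Type*} [AddCommGroup V] [Module ℝ V] [TopologicalSpace V]
    [AddCommGroup W] [Module ℝ W] [TopologicalSpace W] (L : V →L[ℝ] W) (P : CBivector V) :
    CBivector W :=
  P.compLinearMap (covectorPullback L)

/-- The `(1,0)`-part `α^{1,0} = ½ (α - i α ∘ J)` of a complex covector with respect to a complex
structure `J`. -/
def covector10 {V : Type*} [AddCommGroup V] [Module ℝ V] [TopologicalSpace V]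
    (J : V →L[ℝ] V) : (V →L[ℝ] ℂ) →ₗ[ℂ] (V →L[ℝ] ℂ) :=
  (1 / 2 : ℂ) • (LinearMap.id - Complex.I • covectorPullback J)

/-- The `(2,0)`-part of a complex bivector with respect to a complex structure `J`, i.e. its
component in `Λ² T^{1,0}`; it pairs with covectors through their `(1,0)`-parts. -/
def CBivector.part20 {V : Type*} [AddCommGroup V] [Module ℝ V] [TopologicalSpace V]
    (J : V →L[ℝ] V) (P : CBivector V) : CBivector V :=
  P.compLinearMap (covector10 J)

/-! ### Bivector fields on (almost) complex manifolds -/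

section Manifold

variable {F : Type*} [NormedAddCommGroup F] [NormedSpace ℝ F]
  {H : Type*} [TopologicalSpace H] {𝓜 : ModelWithCorners ℝ F H}
  {X : Type*} [TopologicalSpace X] [ChartedSpace H X]

/-- A local holomorphic coordinate system for the endomorphism field `𝓘` of the tangent bundle:
a local diffeomorphism `φ` onto an open subset of `ℂⁿ` with `dφ ∘ 𝓘 = i dφ`. -/
structure IsHolomorphicChart (𝓘 : ∀ x : X, TangentSpace 𝓜 x →L[ℝ] TangentSpace 𝓜 x)
    {n : ℕ} (φ : OpenPartialHomeomorph X (Fin n → ℂ)) : Prop where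
  contMDiffOn : ContMDiffOn 𝓜 𝓘(ℝ, Fin n → ℂ) ∞ φ φ.source
  contMDiffOn_symm : ContMDiffOn 𝓘(ℝ, Fin n → ℂ) 𝓜 ∞ φ.symm φ.target
  complexLinear : ∀ x ∈ φ.source, ∀ v : TangentSpace 𝓜 x,
    mvfderiv 𝓜 φ x (𝓘 x v) = Complex.I • mvfderiv 𝓜 φ x v

/-- `𝓘` is an (integrable) complex structure: it squares to `-1`, and there are holomorphic
coordinates around every point. -/
def IsComplexStructure (𝓘 : ∀ x : X, TangentSpace 𝓜 x →L[ℝ] TangentSpace 𝓜 x) : Prop :=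
  (∀ (x : X) (v : TangentSpace 𝓜 x), 𝓘 x (𝓘 x v) = -v) ∧
    ∀ x : X, ∃ (n : ℕ) (φ : OpenPartialHomeomorph X (Fin n → ℂ)),
      x ∈ φ.source ∧ IsHolomorphicChart 𝓘 φ

/-- `f` is a holomorphic function on the open set `U`: smooth, with `df ∘ 𝓘 = i df`. -/
def IsHolomorphicOn (𝓘 : ∀ x : X, TangentSpace 𝓜 x →L[ℝ] TangentSpace 𝓜 x)
    (f : X → ℂ) (U : Set X) : Prop :=
  ContMDiffOn 𝓜 𝓘(ℝ, ℂ) ∞ f U ∧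
    ∀ x ∈ U, ∀ v : TangentSpace 𝓜 x, mvfderiv 𝓜 f x (𝓘 x v) = Complex.I * mvfderiv 𝓜 f x v

/-- The bracket `{f, g} = P(df, dg)` of complex valued functions. -/
def bivectorBracket (P : ∀ x : X, CBivector (TangentSpace 𝓜 x)) (f g : X → ℂ) (x : X) : ℂ :=
  P x ![mvfderiv 𝓜 f x, mvfderiv 𝓜 g x]

/-- The Schouten bracket of `P` with itself, evaluated on differentials:
`[P, P](df, dg, dh) = 2 ({f, {g, h}} + {g, {h, f}} + {h, {f, g}})`. -/
def schoutenSelf (P : ∀ x : X, CBivector (TangentSpace 𝓜 x)) (f g h : X → ℂ) (x : X) : ℂ :=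
  2 * (bivectorBracket P f (bivectorBracket P g h) x
    + bivectorBracket P g (bivectorBracket P h f) x
    + bivectorBracket P h (bivectorBracket P f g) x)

/-- A smooth bivector field: `P(df, dg)` is smooth for all local smooth functions `f`, `g`. -/
def IsSmoothBivector (P : ∀ x : X, CBivector (TangentSpace 𝓜 x)) : Prop :=
  ∀ U : Set X, IsOpen U → ∀ f g : X → ℂ,
    ContMDiffOn 𝓜 𝓘(ℝ, ℂ) ∞ f U → ContMDiffOn 𝓜 𝓘(ℝ, ℂ) ∞ g U →
      ContMDiffOn 𝓜 𝓘(ℝ, ℂ) ∞ (bivectorBracket P f g) U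

/-- A complex Poisson structure: a smooth bivector field of type `(2,0)` with `[P, P] = 0`
(tested on the differentials of all local smooth complex valued functions). -/
structure IsComplexPoisson (𝓘 : ∀ x : X, TangentSpace 𝓜 x →L[ℝ] TangentSpace 𝓜 x)
    (P : ∀ x : X, CBivector (TangentSpace 𝓜 x)) : Prop where
  smooth : IsSmoothBivector P
  type20 : ∀ x : X, (P x).part20 (𝓘 x) = P x
  schouten : ∀ U : Set X, IsOpen U → ∀ f g h : X → ℂ,
    ContMDiffOn 𝓜 𝓘(ℝ, ℂ) ∞ f U → ContMDiffOn 𝓜 𝓘(ℝ, ℂ) ∞ g U →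
      ContMDiffOn 𝓜 𝓘(ℝ, ℂ) ∞ h U → ∀ x ∈ U, schoutenSelf P f g h x = 0

/-- A holomorphic Poisson structure: a complex Poisson structure whose components
`P^{jk} = P(dz^j, dz^k)` in all local holomorphic coordinates are holomorphic functions. -/
structure IsHolomorphicPoisson (𝓘 : ∀ x : X, TangentSpace 𝓜 x →L[ℝ] TangentSpace 𝓜 x)
    (P : ∀ x : X, CBivector (TangentSpace 𝓜 x)) : Prop extends IsComplexPoisson 𝓘 P where
  holomorphic : ∀ (n : ℕ) (φ : OpenPartialHomeomorph X (Fin n → ℂ)), IsHolomorphicChart 𝓘 φ →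
    ∀ j k : Fin n,
      IsHolomorphicOn 𝓘 (bivectorBracket P (fun x => φ x j) (fun x => φ x k)) φ.source

end Manifold

/-! ### Flat hyperkähler tori -/

/-- A linear hyperkähler structure on a Euclidean vector space: two anticommuting orthogonal
complex structures `I` and `J`; the third one is `K = IJ = -JI`. -/
structure LinearHyperkahler (E : Type*) [NormedAddCommGroup E] [InnerProductSpace ℝ E] where
  /-- the first complex structure -/
  I : E →L[ℝ] E
  /-- the second complex structure -/
  J : E →L[ℝ] E
  I_sq : ∀ v, I (I v) = -v
  J_sq : ∀ v, J (J v) = -v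
  anticomm : ∀ v, I (J v) = -J (I v)
  inner_I : ∀ v w, ⟪I v, I w⟫_ℝ = ⟪v, w⟫_ℝ
  inner_J : ∀ v w, ⟪J v, J w⟫_ℝ = ⟪v, w⟫_ℝ

/-- The unit sphere `S²` in Euclidean three-space. -/
abbrev TwoSphere : Type := Metric.sphere (0 : EuclideanSpace ℝ (Fin 3)) 1

namespace LinearHyperkahler

variable {E : Type*} [NormedAddCommGroup E] [InnerProductSpace ℝ E] (h : LinearHyperkahler E)

/-- The third complex structure `K = IJ`. -/
def K : E →L[ℝ] E := h.I.comp h.J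

/-- The complex structure `I_𝐚 = a I + b J + c K` for `𝐚 = (a, b, c) ∈ S²`. -/
def structureAt (a : TwoSphere) : E →L[ℝ] E :=
  a.1 0 • h.I + a.1 1 • h.J + a.1 2 • h.K

/-- The fundamental form `ω(X, Y) = g(IX, Y)` of `I`. -/
def fundamentalForm (v w : E) : ℝ := ⟪h.I v, w⟫_ℝ

variable [CompleteSpace E]

/-- The map `ω⁻¹ = -I ∘ ♯` from covectors to vectors. -/
def formInv (α : E →L[ℝ] ℝ) : E := -h.I ((InnerProductSpace.toDual ℝ E).symm α)

/-- The defining property of `ω⁻¹`. -/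
theorem fundamentalForm_formInv (α : E →L[ℝ] ℝ) (w : E) :
    h.fundamentalForm (h.formInv α) w = α w := by
  simp [fundamentalForm, formInv, h.I_sq]

theorem formInv_add (α β : E →L[ℝ] ℝ) : h.formInv (α + β) = h.formInv α + h.formInv β := by
  simp [formInv, add_comm]

theorem formInv_smul (r : ℝ) (α : E →L[ℝ] ℝ) : h.formInv (r • α) = r • h.formInv α := by
  simp [formInv]

theorem apply_formInv_swap (α β : E →L[ℝ] ℝ) : β (h.formInv α) = -α (h.formInv β) := by
  rw [← h.fundamentalForm_formInv β, ← h.fundamentalForm_formInv α]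
  simp only [fundamentalForm]
  rw [← h.inner_I (h.I (h.formInv β)), h.I_sq, inner_neg_left, real_inner_comm]

/-- The bivector `P_I(α, β) = β(ω⁻¹ α)` dual to the fundamental form of `I`, extended
`ℂ`-bilinearly to complex covectors. -/
def bivector : CBivector E where
  toFun α :=
    ⟨Complex.reCLM.comp (α 1) (h.formInv (Complex.reCLM.comp (α 0)))
        - Complex.imCLM.comp (α 1) (h.formInv (Complex.imCLM.comp (α 0))),
      Complex.imCLM.comp (α 1) (h.formInv (Complex.reCLM.comp (α 0)))
        + Complex.reCLM.comp (α 1) (h.formInv (Complex.imCLM.comp (α 0)))⟩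
  map_update_add' α i x y := by
    have e1 : Complex.reCLM.comp (x + y) = Complex.reCLM.comp x + Complex.reCLM.comp y := by
      ext; simp
    have e2 : Complex.imCLM.comp (x + y) = Complex.imCLM.comp x + Complex.imCLM.comp y := by
      ext; simp
    fin_cases i <;> apply Complex.ext <;>
      simp [e1, e2, h.formInv_add] <;> ring
  map_update_smul' α i c x := by
    have e1 : Complex.reCLM.comp (c • x)
        = c.re • Complex.reCLM.comp x + (-c.im) • Complex.imCLM.comp x := by
      ext; simp [sub_eq_add_neg]
    have e2 : Complex.imCLM.comp (c • x)
        = c.re • Complex.imCLM.comp x + c.im • Complex.reCLM.comp x := by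
      ext; simp
    fin_cases i <;> apply Complex.ext <;>
      simp [e1, e2, h.formInv_add, h.formInv_smul] <;> ring
  map_eq_zero_of_eq' α i j hij hne := by
    have h01 : α 0 = α 1 := by
      fin_cases i <;> fin_cases j <;> simp_all
    have s1 := h.apply_formInv_swap (Complex.reCLM.comp (α 1)) (Complex.reCLM.comp (α 1))
    have s2 := h.apply_formInv_swap (Complex.imCLM.comp (α 1)) (Complex.imCLM.comp (α 1))
    have s3 := h.apply_formInv_swap (Complex.reCLM.comp (α 1)) (Complex.imCLM.comp (α 1))
    apply Complex.ext <;> simp only [h01, Complex.zero_re, Complex.zero_im] <;> linarith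

end LinearHyperkahler

section Torus

variable {E : Type*} [NormedAddCommGroup E]

/-- The torus `E / Γ`, for a lattice `Γ` in the vector space `E`. -/
abbrev FlatTorus (Γ : Submodule ℤ E) : Type _ := E ⧸ Γ.toAddSubgroup

variable (Γ : Submodule ℤ E) [DiscreteTopology Γ]

theorem FlatTorus.isLocalHomeomorph_mk :
    IsLocalHomeomorph (QuotientAddGroup.mk : E → FlatTorus Γ) := by
  have hd : DiscreteTopology Γ := inferInstance
  have hΓ : IsDiscrete ((Γ.toAddSubgroup : AddSubgroup E) : Set E) := ⟨hd⟩
  exact (Γ.toAddSubgroup.isAddQuotientCoveringMap_of_comm hΓ).isCoveringMap.isLocalHomeomorph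

/-- The smooth structure of the torus, with local inverses of the projection as charts. -/
instance FlatTorus.instChartedSpace : ChartedSpace E (FlatTorus Γ) :=
  (FlatTorus.isLocalHomeomorph_mk Γ).chartedSpace QuotientAddGroup.mk_surjective

/-- A continuous map of `E` that covers the identity of `E / Γ` is locally a translation. -/
theorem FlatTorus.eventuallyEq_translation {ψ : E → E} {s : Set E} (hs : IsOpen s)
    (hc : ContinuousOn ψ s)
    (hψ : ∀ v ∈ s, (QuotientAddGroup.mk (ψ v) : FlatTorus Γ) = QuotientAddGroup.mk v)
    {x : E} (hx : x ∈ s) : ∀ᶠ v in nhds x, ψ v = v + (ψ x - x) := by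
  have hd : DiscreteTopology Γ := inferInstance
  obtain ⟨W, hW, hWΓ⟩ : ∃ W : Set E, IsOpen W ∧ W ∩ (Γ : Set E) = {0} := by
    obtain ⟨W, hW, h⟩ := isOpen_induced_iff.1 (isOpen_discrete ({0} : Set Γ))
    refine ⟨W, hW, ?_⟩
    ext y
    constructor
    · rintro ⟨hy, hyΓ⟩
      have : (⟨y, hyΓ⟩ : Γ) ∈ Subtype.val ⁻¹' W := hy
      rw [h] at this
      simpa [Subtype.ext_iff] using this
    · rintro rfl
      have : (0 : Γ) ∈ Subtype.val ⁻¹' W := by rw [h]; rfl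
      exact ⟨this, Γ.zero_mem⟩
  have hmem : ∀ v ∈ s, ψ v - v ∈ Γ := fun v hv => by
    have := (QuotientAddGroup.eq (s := Γ.toAddSubgroup)).1 (hψ v hv).symm
    rw [neg_add_eq_sub] at this
    exact this
  have hcx : ContinuousAt (fun v => (ψ v - v) - (ψ x - x)) x :=
    ((hc.continuousAt (hs.mem_nhds hx)).sub continuousAt_id).sub continuousAt_const
  have h0 : (0 : E) ∈ W := (hWΓ.ge rfl).1
  have hW' : W ∈ nhds ((ψ x - x) - (ψ x - x)) := by
    rw [sub_self]; exact hW.mem_nhds h0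
  filter_upwards [hcx hW', hs.mem_nhds hx] with v hv hvs
  have : (ψ v - v) - (ψ x - x) ∈ W ∩ (Γ : Set E) :=
    ⟨hv, Γ.sub_mem (hmem v hvs) (hmem x hx)⟩
  rw [hWΓ, Set.mem_singleton_iff, sub_eq_zero] at this
  rw [← this]
  abel

/-- The charts of the torus are local inverses of the projection. -/
theorem FlatTorus.symm_eq_mk_of_mem_atlas {e : OpenPartialHomeomorph (FlatTorus Γ) E}
    (he : e ∈ atlas E (FlatTorus Γ)) (v : E) : e.symm v = QuotientAddGroup.mk v := by
  obtain ⟨q, rfl⟩ := he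
  simp [chartAt_self_eq]

variable [NormedSpace ℝ E]

instance FlatTorus.instIsManifold : IsManifold 𝓘(ℝ, E) ∞ (FlatTorus Γ) := by
  refine isManifold_of_contDiffOn _ _ _ fun e e' he he' => ?_
  simp only [modelWithCornersSelf_coe, modelWithCornersSelf_coe_symm, Function.id_comp,
    Function.comp_id, Set.range_id, Set.inter_univ, Set.preimage_id_eq, id_eq]
  intro x hx
  have hev := FlatTorus.eventuallyEq_translation Γ (ψ := e.symm.trans e')
    (e.symm.trans e').open_source (e.symm.trans e').continuousOn (fun v hv => by
      have hv' : e.symm v ∈ e'.source := by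
        rw [OpenPartialHomeomorph.trans_source] at hv
        exact hv.2
      rw [← FlatTorus.symm_eq_mk_of_mem_atlas Γ he', OpenPartialHomeomorph.coe_trans,
        Function.comp_apply, e'.left_inv hv', FlatTorus.symm_eq_mk_of_mem_atlas Γ he]) hx
  exact ((contDiffAt_id.add contDiffAt_const).congr_of_eventuallyEq hev).contDiffWithinAt

/-- The tangent spaces of the torus are identified with `E` by the differential of the
projection `E → E / Γ`. -/
theorem FlatTorus.hasMFDerivAt_mk (x : E) :
    HasMFDerivAt 𝓘(ℝ, E) 𝓘(ℝ, E) (QuotientAddGroup.mk : E → FlatTorus Γ) x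
      (ContinuousLinearMap.id ℝ E) := by
  have hcont : Continuous (QuotientAddGroup.mk : E → FlatTorus Γ) :=
    (FlatTorus.isLocalHomeomorph_mk Γ).continuous
  refine ⟨hcont.continuousAt, ?_⟩
  have hat := chart_mem_atlas E (QuotientAddGroup.mk x : FlatTorus Γ)
  have hev := FlatTorus.eventuallyEq_translation Γ
    (ψ := fun v => chartAt E (QuotientAddGroup.mk x : FlatTorus Γ) (QuotientAddGroup.mk v))
    (s := QuotientAddGroup.mk ⁻¹' (chartAt E (QuotientAddGroup.mk x : FlatTorus Γ)).source)
    ((chartAt E (QuotientAddGroup.mk x : FlatTorus Γ)).open_source.preimage hcont)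
    ((chartAt E (QuotientAddGroup.mk x : FlatTorus Γ)).continuousOn.comp hcont.continuousOn
      fun _ h => h)
    (fun v hv => by
      rw [← FlatTorus.symm_eq_mk_of_mem_atlas Γ hat]
      exact OpenPartialHomeomorph.left_inv _ hv)
    (x := x) (mem_chart_source E (QuotientAddGroup.mk x : FlatTorus Γ))
  have h1 : HasFDerivAt (fun v => v + (chartAt E (QuotientAddGroup.mk x : FlatTorus Γ)
      (QuotientAddGroup.mk x) - x)) (ContinuousLinearMap.id ℝ E) x :=
    (hasFDerivAt_id x).add_const _
  have h2 := (h1.congr_of_eventuallyEq hev).hasFDerivWithinAt (s := Set.univ)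
  simp only [writtenInExtChartAt, extChartAt, chartAt_self_eq, mfld_simps,
    Function.comp_def]
  exact h2

end Torus

/-! ### The two-sphere as a complex curve -/

namespace TwoSphere

instance instFactFinrank : Fact (Module.finrank ℝ (EuclideanSpace ℝ (Fin 3)) = 2 + 1) :=
  ⟨finrank_euclideanSpace_fin⟩

/-- The differential of the inclusion `S² → ℝ³`, as an isomorphism from the tangent space at `𝐚`
to the plane orthogonal to `𝐚`. -/
def tangentEquiv (a : TwoSphere) :
    TangentSpace (𝓡 2) a ≃ₗ[ℝ] (Submodule.span ℝ {(a : EuclideanSpace ℝ (Fin 3))})ᗮ :=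
  (LinearEquiv.ofInjective
    (mvfderiv (𝓡 2) ((↑) : TwoSphere → EuclideanSpace ℝ (Fin 3)) a).toLinearMap
    (injective_mvfderiv_subtypeVal_sphere a)).trans
    (LinearEquiv.ofEq _ _ (range_mvfderiv_subtypeVal a))

/-- The rotation `v ↦ 𝐚 × v` by a right angle of the plane orthogonal to `𝐚`. -/
def rotation (a : TwoSphere) :
    (Submodule.span ℝ {(a : EuclideanSpace ℝ (Fin 3))})ᗮ →ₗ[ℝ]
      (Submodule.span ℝ {(a : EuclideanSpace ℝ (Fin 3))})ᗮ :=
  LinearMap.codRestrict _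
    ((WithLp.linearEquiv 2 ℝ (Fin 3 → ℝ)).symm.toLinearMap ∘ₗ
      crossProduct (WithLp.ofLp a.1) ∘ₗ (WithLp.linearEquiv 2 ℝ (Fin 3 → ℝ)).toLinearMap ∘ₗ
        (Submodule.subtype _))
    (by
      intro v
      rw [Submodule.mem_orthogonal_singleton_iff_inner_right]
      simp [PiLp.inner_apply, Fin.sum_univ_three, cross_apply]
      ring)

/-- The canonical complex structure `I_{S²}` of the sphere: `v ↦ 𝐚 × v` on `T_𝐚 S² = 𝐚^⊥`. -/
def complexStructure (a : TwoSphere) : TangentSpace (𝓡 2) a →L[ℝ] TangentSpace (𝓡 2) a :=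
  LinearMap.toContinuousLinearMap (𝕜 := ℝ) (E := EuclideanSpace ℝ (Fin 2))
    (F' := EuclideanSpace ℝ (Fin 2))
    ((tangentEquiv a).symm.toLinearMap ∘ₗ rotation a ∘ₗ (tangentEquiv a).toLinearMap)

/-- The defining property of `I_{S²}`, in terms of the differential of the inclusion `S² → ℝ³`. -/
theorem mvfderiv_complexStructure (a : TwoSphere) (v : TangentSpace (𝓡 2) a) :
    WithLp.ofLp (mvfderiv (𝓡 2) ((↑) : TwoSphere → EuclideanSpace ℝ (Fin 3)) a
      (complexStructure a v)) =
    crossProduct (WithLp.ofLp a.1) (WithLp.ofLp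
      (mvfderiv (𝓡 2) ((↑) : TwoSphere → EuclideanSpace ℝ (Fin 3)) a v)) := by
  have key : ∀ u, mvfderiv (𝓡 2) ((↑) : TwoSphere → EuclideanSpace ℝ (Fin 3)) a u =
    (tangentEquiv a u).1 := fun _ => rfl
  have hv : complexStructure a v =
    (tangentEquiv a).symm (rotation a (tangentEquiv a v)) := rfl
  rw [key, key, hv, LinearEquiv.apply_symm_apply]
  rfl

/-- The stereographic coordinate `λ = (c + i b) / (1 - a)` of `𝐚 = (a, b, c) ≠ (1, 0, 0)`. It takes
the value `i` at `J = (0, 1, 0)`, `1` at `K = (0, 0, 1)`, `0` at `-I = (-1, 0, 0)`, and `∞` at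
`I = (1, 0, 0)`. -/
def lam (a : TwoSphere) : ℂ := ⟨a.1 2, a.1 1⟩ / ((1 - a.1 0 : ℝ) : ℂ)

/-- The stereographic coordinate `1 / λ = (c - i b) / (1 + a)` of `𝐚 = (a, b, c) ≠ (-1, 0, 0)`. -/
def lamInv (a : TwoSphere) : ℂ := ⟨a.1 2, -a.1 1⟩ / ((1 + a.1 0 : ℝ) : ℂ)

theorem lam_mul_lamInv (a : TwoSphere) (h₁ : a.1 0 ≠ 1) (h₂ : a.1 0 ≠ -1) :
    lam a * lamInv a = 1 := by
  have hs : a.1 0 ^ 2 + a.1 1 ^ 2 + a.1 2 ^ 2 = 1 := by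
    have := EuclideanSpace.norm_sq_eq a.1
    simp only [norm_eq_of_mem_sphere, Fin.sum_univ_three, Real.norm_eq_abs, sq_abs] at this
    linarith
  have e1 : ((1 - a.1 0 : ℝ) : ℂ) ≠ 0 := by
    rw [Complex.ofReal_ne_zero]; exact fun e => h₁ (by linarith)
  have e2 : ((1 + a.1 0 : ℝ) : ℂ) ≠ 0 := by
    rw [Complex.ofReal_ne_zero]; exact fun e => h₂ (by linarith)
  rw [lam, lamInv, div_mul_div_comm, div_eq_one_iff_eq (mul_ne_zero e1 e2),
    ← Complex.ofReal_mul]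
  apply Complex.ext
  · simp only [Complex.mul_re, Complex.ofReal_re]; linarith
  · simp only [Complex.mul_im, Complex.ofReal_im]; ring

end TwoSphere

/-! ### The twistor space -/

namespace LinearHyperkahler

variable {E : Type*} [NormedAddCommGroup E] [InnerProductSpace ℝ E]
  (h : LinearHyperkahler E) (Γ : Submodule ℤ E) [DiscreteTopology Γ]

/-- The tautological complex structure `𝓘 = (I_𝐚, I_{S²})` at the point `(x, 𝐚)` of the twistor
space `Z = M × S²` of the torus `M = E / Γ`. -/
def twistorStructure (z : FlatTorus Γ × TwoSphere) :
    TangentSpace (𝓘(ℝ, E).prod (𝓡 2)) z →L[ℝ] TangentSpace (𝓘(ℝ, E).prod (𝓡 2)) z :=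
  (show TangentSpace 𝓘(ℝ, E) z.1 →L[ℝ] TangentSpace 𝓘(ℝ, E) z.1 from
    h.structureAt z.2).prodMap (TwoSphere.complexStructure z.2)

variable [CompleteSpace E]

/-- The bivector field `P_I` on the torus `M = E / Γ`. -/
def torusBivector (x : FlatTorus Γ) : CBivector (TangentSpace 𝓘(ℝ, E) x) :=
  h.bivector

/-- The bivector field `𝒫` on the twistor space: at `(x, 𝐚)`, the `(2,0)`-part with respect to `𝓘`
of the push-forward of `P_I` under the section `s_𝐚 : x ↦ (x, 𝐚)`. -/
def twistorBivector (z : FlatTorus Γ × TwoSphere) :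
    CBivector (TangentSpace (𝓘(ℝ, E).prod (𝓡 2)) z) :=
  ((h.torusBivector Γ z.1).pushforward
    (mfderiv 𝓘(ℝ, E) (𝓘(ℝ, E).prod (𝓡 2))
      (fun x : FlatTorus Γ => (x, z.2)) z.1)).part20 (h.twistorStructure Γ z)

end LinearHyperkahler

end

/-! The proof exhibits explicit holomorphic charts of `Z` in which all three bivector fields have
the form $l^kB$, with $B$ constant and $l$ the stereographic coordinate. A sign $\varepsilon=\pm1$
treats both poles at once: `stereo ε` is $\lambda$ for $\varepsilon=1$ and $1/\lambda$ for
$\varepsilon=-1$, and it is finite away from ${\bf a}=(\varepsilon,0,0)$.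

Make $E$ complex by letting $i$ act as $-\varepsilon I$. The map $v\mapsto v-\varepsilon l\,Jv$
(`shear ε l`) is invertible, carries $I_{\bf a}$ to $-\varepsilon I$ (`shear_structureAt`), and
depends holomorphically on $l$ (`shearVar_I_mul`). Hence $(x,{\bf a})\mapsto(x-\varepsilon
l\,Jx,\,l)$ is a local holomorphic chart, and the two signs cover $Z$.

A $(1,0)$-covector $\alpha$ for $-\varepsilon I$ pulls back under the shear to $\alpha-\varepsilon
l\,\alpha\circ J$, where $\alpha\circ J$ has type $(0,1)$. Since $P_I$ has type $(1,1)$ for $I$,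
only the mixed terms of $P_I(\alpha-\varepsilon l\,\alpha J,\ \beta-\varepsilon l\,\beta J)$
survive, and these are linear in $l$ (`bivector_comp_shear`). So $\mathcal P=lB$ in the chart, with
$B$ constant and tangent to the fibres. Multiplying by $1/l$ gives $B$ in this chart, and $l'^2B'$
in the chart of the opposite sign, where $l'=1/l$; both forms extend over the poles.

Because $B$ annihilates $dl$, the function $l^k$ is a Casimir. The Jacobi identity for $l^kB$ then
reduces to that of a constant bivector (`modelBracket_jacobi`), which is symmetry of second
derivatives. `isHolomorphicPoisson_of_charts` transfers this to the manifold. -/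

/-! ### Bivectors on a normed space in coordinates -/

section Model

variable {V : Type*} [NormedAddCommGroup V] [NormedSpace ℝ V] [FiniteDimensional ℝ V]

/-- The complexified coordinate covectors of the standard real basis of `V`. -/
noncomputable def coordCovector (V : Type*) [NormedAddCommGroup V] [NormedSpace ℝ V]
    [FiniteDimensional ℝ V] (i : Fin (Module.finrank ℝ V)) : V →L[ℝ] ℂ :=
  Complex.ofRealCLM.comp (LinearMap.toContinuousLinearMap ((Module.finBasis ℝ V).coord i))

theorem covector_eq_sum_coordCovector (α : V →L[ℝ] ℂ) :
    α = ∑ i, α (Module.finBasis ℝ V i) • coordCovector V i := by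
  ext v
  conv_lhs => rw [← (Module.finBasis ℝ V).sum_repr v]
  simp only [map_sum, map_smul, sum_apply, smul_apply]
  refine Finset.sum_congr rfl fun i _ => ?_
  simp [coordCovector, mul_comm]

theorem CBivector.swap {V : Type*} [AddCommGroup V] [Module ℝ V] [TopologicalSpace V]
    (B : CBivector V) (α β : V →L[ℝ] ℂ) : B ![α, β] = -B ![β, α] := by
  have := B.map_swap ![β, α] (i := 0) (j := 1) (by decide)
  rw [← this]
  congr 1
  ext i
  fin_cases i <;> rfl

theorem CBivector.add_left {V : Type*} [AddCommGroup V] [Module ℝ V] [TopologicalSpace V]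
    (B : CBivector V) (α α' β : V →L[ℝ] ℂ) : B ![α + α', β] = B ![α, β] + B ![α', β] :=
  B.map_vecCons_add _ _ _

theorem CBivector.smul_left {V : Type*} [AddCommGroup V] [Module ℝ V] [TopologicalSpace V]
    (B : CBivector V) (c : ℂ) (α β : V →L[ℝ] ℂ) : B ![c • α, β] = c * B ![α, β] :=
  B.map_vecCons_smul _ _ _

theorem CBivector.add_right {V : Type*} [AddCommGroup V] [Module ℝ V] [TopologicalSpace V]
    (B : CBivector V) (α β β' : V →L[ℝ] ℂ) : B ![α, β + β'] = B ![α, β] + B ![α, β'] := by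
  rw [B.swap, B.add_left, B.swap α β, B.swap α β']; ring

theorem CBivector.smul_right {V : Type*} [AddCommGroup V] [Module ℝ V] [TopologicalSpace V]
    (B : CBivector V) (c : ℂ) (α β : V →L[ℝ] ℂ) : B ![α, c • β] = c * B ![α, β] := by
  rw [B.swap, B.smul_left, B.swap α β]; ring

/-- A complex bivector as a `ℂ`-bilinear map. -/
noncomputable def CBivector.toBilin {V : Type*} [AddCommGroup V] [Module ℝ V] [TopologicalSpace V]
    (B : CBivector V) : (V →L[ℝ] ℂ) →ₗ[ℂ] (V →L[ℝ] ℂ) →ₗ[ℂ] ℂ :=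
  LinearMap.mk₂ ℂ (fun α β => B ![α, β]) B.add_left B.smul_left B.add_right B.smul_right

theorem CBivector.toBilin_apply {V : Type*} [AddCommGroup V] [Module ℝ V] [TopologicalSpace V]
    (B : CBivector V) (α β : V →L[ℝ] ℂ) : B.toBilin α β = B ![α, β] := rfl

/-- The components of a complex bivector in the standard real basis of `V`. -/
noncomputable def CBivector.coeff (B : CBivector V) (i j : Fin (Module.finrank ℝ V)) : ℂ :=
  B ![coordCovector V i, coordCovector V j]

theorem CBivector.coeff_swap (B : CBivector V) (i j : Fin (Module.finrank ℝ V)) :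
    B.coeff i j = -B.coeff j i := B.swap _ _

theorem CBivector.apply_eq_sum (B : CBivector V) (α β : V →L[ℝ] ℂ) :
    B ![α, β] = ∑ i, ∑ j, B.coeff i j *
      (α (Module.finBasis ℝ V i) * β (Module.finBasis ℝ V j)) := by
  have hr : ∀ γ : V →L[ℝ] ℂ, B ![γ, β] = ∑ j, β (Module.finBasis ℝ V j) *
      B ![γ, coordCovector V j] := fun γ => by
    rw [← B.toBilin_apply]
    conv_lhs => rw [covector_eq_sum_coordCovector β]
    simp only [map_sum, map_smul, smul_eq_mul]
    rfl
  have hl : B ![α, β] = ∑ i, α (Module.finBasis ℝ V i) * B ![coordCovector V i, β] := by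
    rw [← B.toBilin_apply]
    conv_lhs => rw [covector_eq_sum_coordCovector α]
    simp only [map_sum, map_smul, LinearMap.sum_apply, LinearMap.smul_apply, smul_eq_mul]
    rfl
  rw [hl]
  refine Finset.sum_congr rfl fun i _ => ?_
  rw [hr, Finset.mul_sum]
  refine Finset.sum_congr rfl fun j _ => ?_
  rw [CBivector.coeff]
  ring

/-! ### The Jacobi identity for a constant bivector times a Casimir function -/

/-- The bracket defined by the bivector field `u • B` on `V`, where `B` is constant. -/
noncomputable def modelBracket (u : V → ℂ) (B : CBivector V) (F G : V → ℂ) (w : V) : ℂ :=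
  u w * B ![fderiv ℝ F w, fderiv ℝ G w]

theorem modelBracket_eq_sum (u : V → ℂ) (B : CBivector V) (F G : V → ℂ) (w : V) :
    modelBracket u B F G w = u w * ∑ i, ∑ j, B.coeff i j *
      (fderiv ℝ F w (Module.finBasis ℝ V i) * fderiv ℝ G w (Module.finBasis ℝ V j)) := by
  rw [modelBracket, B.apply_eq_sum]

theorem ContDiffOn.fderiv_apply_const {V : Type*} [NormedAddCommGroup V] [NormedSpace ℝ V]
    {F : V → ℂ} {O : Set V} (hO : IsOpen O)
    (hF : ContDiffOn ℝ ∞ F O) (e : V) : ContDiffOn ℝ ∞ (fun w => fderiv ℝ F w e) O :=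
  (hF.fderiv_of_isOpen hO (m := ∞) (by simp)).clm_apply contDiffOn_const

theorem ContDiffOn.modelBracket {u : V → ℂ} (B : CBivector V) {F G : V → ℂ} {O : Set V}
    (hO : IsOpen O) (hu : ContDiffOn ℝ ∞ u O) (hF : ContDiffOn ℝ ∞ F O)
    (hG : ContDiffOn ℝ ∞ G O) : ContDiffOn ℝ ∞ (modelBracket u B F G) O := by
  refine ContDiffOn.congr ?_ fun w _ => modelBracket_eq_sum u B F G w
  exact hu.mul (ContDiffOn.sum fun i _ => ContDiffOn.sum fun j _ => contDiffOn_const.mul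
    ((hF.fderiv_apply_const hO _).mul (hG.fderiv_apply_const hO _)))

/-- The expression `B(α, B(S ·, β))` for a bilinear form with matrix `S`. -/
noncomputable def CBivector.contract (B : CBivector V)
    (S : Fin (Module.finrank ℝ V) → Fin (Module.finrank ℝ V) → ℂ)
    (p q : Fin (Module.finrank ℝ V) → ℂ) : ℂ :=
  ∑ i, ∑ j, ∑ k, ∑ l, B.coeff i j * B.coeff k l * (p k * q j * S i l)

/-- Reversing the order of the four summation indices exchanges `p` and `q` and transposes `S`; the
two signs produced by the skew-symmetry of `B` cancel. -/
theorem CBivector.contract_swap (B : CBivector V)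
    {S : Fin (Module.finrank ℝ V) → Fin (Module.finrank ℝ V) → ℂ}
    (hS : ∀ i j, S i j = S j i) (p q : Fin (Module.finrank ℝ V) → ℂ) :
    B.contract S p q = B.contract S q p := by
  have e : ∀ (f : Fin (Module.finrank ℝ V) → Fin (Module.finrank ℝ V) →
      Fin (Module.finrank ℝ V) → Fin (Module.finrank ℝ V) → ℂ),
      ∑ i, ∑ j, ∑ k, ∑ l, f i j k l = ∑ i, ∑ j, ∑ k, ∑ l, f l k j i := by
    intro f
    calc ∑ i, ∑ j, ∑ k, ∑ l, f i j k l
        = ∑ x : Fin (Module.finrank ℝ V) × Fin (Module.finrank ℝ V) ×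
            Fin (Module.finrank ℝ V) × Fin (Module.finrank ℝ V), f x.1 x.2.1 x.2.2.1 x.2.2.2 := by
          simp only [Fintype.sum_prod_type]
      _ = ∑ x : Fin (Module.finrank ℝ V) × Fin (Module.finrank ℝ V) ×
            Fin (Module.finrank ℝ V) × Fin (Module.finrank ℝ V), f x.2.2.2 x.2.2.1 x.2.1 x.1 :=
          Fintype.sum_equiv
            ⟨fun x => (x.2.2.2, x.2.2.1, x.2.1, x.1), fun x => (x.2.2.2, x.2.2.1, x.2.1, x.1),
              fun _ => rfl, fun _ => rfl⟩ _ _ fun _ => rfl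
      _ = _ := by simp only [Fintype.sum_prod_type]
  rw [contract, e]
  refine Finset.sum_congr rfl fun i _ => Finset.sum_congr rfl fun j _ =>
    Finset.sum_congr rfl fun k _ => Finset.sum_congr rfl fun l _ => ?_
  rw [hS l i, B.coeff_swap l k, B.coeff_swap j i]
  ring

theorem fderiv_fderiv_apply_comm {V : Type*} [NormedAddCommGroup V] [NormedSpace ℝ V]
    {F : V → ℂ} {O : Set V} (hO : IsOpen O) (hF : ContDiffOn ℝ ∞ F O)
    {w : V} (hw : w ∈ O) (a b : V) :
    fderiv ℝ (fun w' => fderiv ℝ F w' a) w b = fderiv ℝ (fun w' => fderiv ℝ F w' b) w a := by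
  have hd : DifferentiableAt ℝ (fderiv ℝ F) w :=
    ((hF.fderiv_of_isOpen hO (m := ∞) (by simp)).contDiffAt (hO.mem_nhds hw)).differentiableAt
      (by simp)
  have hsym : IsSymmSndFDerivAt ℝ F w :=
    (hF.contDiffAt (hO.mem_nhds hw)).isSymmSndFDerivAt (by
      simp only [minSmoothness_of_isRCLikeNormedField]; exact WithTop.coe_le_coe.2 le_top)
  have key : ∀ a b : V, fderiv ℝ (fun w' => fderiv ℝ F w' a) w b = fderiv ℝ (fderiv ℝ F) w b a := by
    intro a b
    rw [fderiv_clm_apply hd (differentiableAt_const a)]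
    simp
  rw [key, key]
  exact hsym _ _

/-- The matrix of second derivatives in the standard real basis. -/
noncomputable def secondDeriv (F : V → ℂ) (w : V) (i l : Fin (Module.finrank ℝ V)) : ℂ :=
  fderiv ℝ (fun w' => fderiv ℝ F w' (Module.finBasis ℝ V i)) w (Module.finBasis ℝ V l)

theorem secondDeriv_swap {F : V → ℂ} {O : Set V} (hO : IsOpen O) (hF : ContDiffOn ℝ ∞ F O)
    {w : V} (hw : w ∈ O) (i l : Fin (Module.finrank ℝ V)) :
    secondDeriv F w i l = secondDeriv F w l i :=
  fderiv_fderiv_apply_comm hO hF hw _ _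

/-- The product rule yields one term for each second derivative and one containing `du`; the latter
vanishes by the Casimir condition, so the factor `u w ^ 2` comes out undifferentiated. -/
theorem modelBracket_modelBracket {u : V → ℂ} {B : CBivector V} {F G H : V → ℂ} {O : Set V}
    (hO : IsOpen O) (hu : ContDiffOn ℝ ∞ u O)
    (hcas : ∀ w ∈ O, ∀ α, B ![α, fderiv ℝ u w] = 0)
    (hG : ContDiffOn ℝ ∞ G O) (hH : ContDiffOn ℝ ∞ H O) {w : V} (hw : w ∈ O) :
    modelBracket u B F (modelBracket u B G H) w = u w ^ 2 *
      (B.contract (secondDeriv G w) (fun k => fderiv ℝ F w (Module.finBasis ℝ V k))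
          (fun k => fderiv ℝ H w (Module.finBasis ℝ V k))
        - B.contract (secondDeriv H w) (fun k => fderiv ℝ F w (Module.finBasis ℝ V k))
          (fun k => fderiv ℝ G w (Module.finBasis ℝ V k))) := by
  have hdiff : ∀ {f : V → ℂ}, ContDiffOn ℝ ∞ f O → HasFDerivAt f (fderiv ℝ f w) w := fun hf =>
    ((hf.contDiffAt (hO.mem_nhds hw)).differentiableAt (by simp)).hasFDerivAt
  set e := Module.finBasis ℝ V
  have hGi : ∀ i, HasFDerivAt (fun w' => fderiv ℝ G w' (e i)) _ w := fun i =>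
    hdiff (hG.fderiv_apply_const hO (e i))
  have hHj : ∀ j, HasFDerivAt (fun w' => fderiv ℝ H w' (e j)) _ w := fun j =>
    hdiff (hH.fderiv_apply_const hO (e j))
  have hder := (hdiff hu).mul (HasFDerivAt.fun_sum (u := Finset.univ) fun i _ =>
    HasFDerivAt.fun_sum (u := Finset.univ) fun j _ =>
      (((hGi i).mul (hHj j)).const_mul (B.coeff i j)))
  have hfun : modelBracket u B G H = fun w' => u w' * ∑ i, ∑ j, B.coeff i j *
      (fderiv ℝ G w' (e i) * fderiv ℝ H w' (e j)) :=
    funext fun w' => modelBracket_eq_sum u B G H w'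
  have hS : ∀ (K : V → ℂ) (i), B.toBilin (fderiv ℝ F w)
      (fderiv ℝ (fun w' => fderiv ℝ K w' (e i)) w)
      = ∑ k, ∑ l, B.coeff k l * (fderiv ℝ F w (e k) * secondDeriv K w i l) := fun K i =>
    B.apply_eq_sum _ _
  have hcas' : B.toBilin (fderiv ℝ F w) (fderiv ℝ u w) = 0 := hcas w hw _
  rw [modelBracket, hfun]
  refine (congrArg (fun α => u w * B.toBilin (fderiv ℝ F w) α) hder.fderiv).trans ?_
  simp only [map_add, map_smul, map_sum, hcas', mul_zero, add_zero, smul_eq_mul, hS]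
  -- Renaming `i` and `j` and using the skew-symmetry of `B` brings the Hessian of `H` to the form
  -- delivered by the product rule, at the cost of a sign.
  have hc2 : B.contract (secondDeriv H w) (fun k => fderiv ℝ F w (e k))
      (fun k => fderiv ℝ G w (e k)) = ∑ i, ∑ j, ∑ k, ∑ l, -(B.coeff i j * B.coeff k l *
        (fderiv ℝ F w (e k) * fderiv ℝ G w (e i) * secondDeriv H w j l)) := by
    rw [CBivector.contract, Finset.sum_comm]
    refine Finset.sum_congr rfl fun i _ => Finset.sum_congr rfl fun j _ =>
      Finset.sum_congr rfl fun k _ => Finset.sum_congr rfl fun l _ => ?_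
    rw [B.coeff_swap j i]
    ring
  rw [hc2, CBivector.contract]
  simp only [Finset.mul_sum, ← Finset.sum_sub_distrib, ← Finset.sum_add_distrib]
  refine Finset.sum_congr rfl fun i _ => Finset.sum_congr rfl fun j _ =>
      Finset.sum_congr rfl fun k _ => Finset.sum_congr rfl fun l _ => ?_
  ring

/-- Each Hessian occurs in two of the three double brackets, with opposite signs and with the other
two functions exchanged; `contract_swap` makes these pairs cancel. -/
theorem modelBracket_jacobi {u : V → ℂ} {B : CBivector V} {F G H : V → ℂ} {O : Set V}
    (hO : IsOpen O) (hu : ContDiffOn ℝ ∞ u O)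
    (hcas : ∀ w ∈ O, ∀ α, B ![α, fderiv ℝ u w] = 0) (hF : ContDiffOn ℝ ∞ F O)
    (hG : ContDiffOn ℝ ∞ G O) (hH : ContDiffOn ℝ ∞ H O) {w : V} (hw : w ∈ O) :
    modelBracket u B F (modelBracket u B G H) w + modelBracket u B G (modelBracket u B H F) w
      + modelBracket u B H (modelBracket u B F G) w = 0 := by
  rw [modelBracket_modelBracket hO hu hcas hG hH hw, modelBracket_modelBracket hO hu hcas hH hF hw,
    modelBracket_modelBracket hO hu hcas hF hG hw,
    B.contract_swap (secondDeriv_swap hO hF hw) _ (fun k => fderiv ℝ H w (Module.finBasis ℝ V k)),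
    B.contract_swap (secondDeriv_swap hO hG hw) _ (fun k => fderiv ℝ H w (Module.finBasis ℝ V k)),
    B.contract_swap (secondDeriv_swap hO hH hw) _ (fun k => fderiv ℝ G w (Module.finBasis ℝ V k))]
  ring

end Model

/-! ### Passing from real to complex differentiability -/

/-- A real differentiable function whose derivative commutes with multiplication by `i` is complex
differentiable. -/
theorem differentiableAt_complex_of_fderiv_I_smul {n : ℕ} {F : (Fin n → ℂ) → ℂ} {w : Fin n → ℂ}
    (hF : DifferentiableAt ℝ F w)
    (hI : ∀ v, fderiv ℝ F w (Complex.I • v) = Complex.I * fderiv ℝ F w v) :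
    DifferentiableAt ℂ F w := by
  let f' : (Fin n → ℂ) →L[ℂ] ℂ :=
    { toFun := fderiv ℝ F w
      map_add' := map_add _
      map_smul' := fun c v => by
        have hc : c • v = c.re • v + c.im • (Complex.I • v) := by
          ext j
          simp only [Pi.smul_apply, Pi.add_apply, smul_eq_mul, Complex.real_smul]
          conv_lhs => rw [← Complex.re_add_im c]
          ring
        rw [hc, map_add, map_smul, map_smul, hI]
        simp only [Complex.real_smul, RingHom.id_apply, smul_eq_mul]
        conv_rhs => rw [← Complex.re_add_im c]
        ring
      cont := (fderiv ℝ F w).cont }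
  exact (hasFDerivAt_of_restrictScalars ℝ (f' := f') hF.hasFDerivAt rfl).differentiableAt

/-- It suffices that directional derivatives of a holomorphic `K` in real directions `e` are
holomorphic. By symmetry of second derivatives, differentiating $dK(e)$ along $iv$ is
differentiating $dK(iv)=i\,dK(v)$ along `e`. -/
theorem DifferentiableOn.modelBracket_complex {n : ℕ} {u F G : (Fin n → ℂ) → ℂ}
    (B : CBivector (Fin n → ℂ)) {O : Set (Fin n → ℂ)} (hO : IsOpen O)
    (hu : DifferentiableOn ℂ u O) (hF : DifferentiableOn ℂ F O) (hG : DifferentiableOn ℂ G O)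
    (hF' : ContDiffOn ℝ ∞ F O) (hG' : ContDiffOn ℝ ∞ G O) :
    DifferentiableOn ℂ (modelBracket u B F G) O := by
  have hd : ∀ {K : (Fin n → ℂ) → ℂ}, DifferentiableOn ℂ K O → ContDiffOn ℝ ∞ K O → ∀ e,
      DifferentiableOn ℂ (fun w => fderiv ℝ K w e) O := by
    intro K hK hK' e w hw
    have hsm : ∀ v, DifferentiableAt ℝ (fun w => fderiv ℝ K w v) w := fun v =>
      ((hK'.fderiv_apply_const hO v).contDiffAt (hO.mem_nhds hw)).differentiableAt (by simp)
    refine (differentiableAt_complex_of_fderiv_I_smul (hsm e) fun v => ?_).differentiableWithinAt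
    rw [fderiv_fderiv_apply_comm hO hK' hw, fderiv_fderiv_apply_comm hO hK' hw e v]
    have hev : (fun w' => fderiv ℝ K w' (Complex.I • v)) =ᶠ[nhds w]
        fun w' => Complex.I * fderiv ℝ K w' v := by
      filter_upwards [hO.mem_nhds hw] with w' hw'
      rw [(hK.differentiableAt (hO.mem_nhds hw')).fderiv_restrictScalars ℝ]
      simp
    rw [hev.fderiv_eq, fderiv_const_mul (hsm v)]
    rfl
  refine DifferentiableOn.congr ?_ fun w _ => modelBracket_eq_sum u B F G w
  exact hu.mul (DifferentiableOn.fun_sum fun i _ => DifferentiableOn.fun_sum fun j _ =>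
    (differentiableOn_const _).mul ((hd hF hF' _).mul (hd hG hG' _)))

/-! ### Poisson structures that are constant up to a Casimir function -/

section PoissonChart

variable {F : Type*} [NormedAddCommGroup F] [NormedSpace ℝ F]
  {H : Type*} [TopologicalSpace H] {𝓜 : ModelWithCorners ℝ F H}
  {X : Type*} [TopologicalSpace X] [ChartedSpace H X]
  {𝓘 : ∀ x : X, TangentSpace 𝓜 x →L[ℝ] TangentSpace 𝓜 x} {n : ℕ}
  {φ : OpenPartialHomeomorph X (Fin n → ℂ)} {P : ∀ x : X, CBivector (TangentSpace 𝓜 x)}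

namespace IsHolomorphicChart

theorem isOpen_preimage (φ : OpenPartialHomeomorph X (Fin n → ℂ)) {U : Set X} (hU : IsOpen U) :
    IsOpen (φ.target ∩ φ.symm ⁻¹' U) :=
  φ.isOpen_inter_preimage_symm hU

theorem contDiffOn_comp_symm (hφ : IsHolomorphicChart 𝓘 φ) {f : X → ℂ} {U : Set X}
    (hf : ContMDiffOn 𝓜 𝓘(ℝ, ℂ) ∞ f U) :
    ContDiffOn ℝ ∞ (f ∘ φ.symm) (φ.target ∩ φ.symm ⁻¹' U) :=
  contMDiffOn_iff_contDiffOn.1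
    (hf.comp (hφ.contMDiffOn_symm.mono Set.inter_subset_left) fun _ hw => hw.2)

theorem mdifferentiableAt (hφ : IsHolomorphicChart 𝓘 φ) {x : X} (hx : x ∈ φ.source) :
    MDifferentiableAt 𝓜 𝓘(ℝ, Fin n → ℂ) φ x :=
  (hφ.contMDiffOn.contMDiffAt (φ.open_source.mem_nhds hx)).mdifferentiableAt (by simp)

theorem mdifferentiableAt_symm (hφ : IsHolomorphicChart 𝓘 φ) {x : X} (hx : x ∈ φ.source) :
    MDifferentiableAt 𝓘(ℝ, Fin n → ℂ) 𝓜 φ.symm (φ x) :=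
  (hφ.contMDiffOn_symm.contMDiffAt
    (φ.open_target.mem_nhds (φ.map_source hx))).mdifferentiableAt (by simp)

theorem mvfderiv_eq (hφ : IsHolomorphicChart 𝓘 φ) {f : X → ℂ} {x : X} (hx : x ∈ φ.source)
    (hf : MDifferentiableAt 𝓜 𝓘(ℝ, ℂ) f x) :
    mvfderiv 𝓜 f x = (fderiv ℝ (f ∘ φ.symm) (φ x)).comp (mvfderiv 𝓜 φ x) := by
  have hev : f =ᶠ[nhds x] (f ∘ φ.symm) ∘ φ := by
    filter_upwards [φ.open_source.mem_nhds hx] with y hy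
    simp [φ.left_inv hy]
  have hf' : MDifferentiableAt 𝓘(ℝ, Fin n → ℂ) 𝓘(ℝ, ℂ) (f ∘ φ.symm) (φ x) := by
    refine MDifferentiableAt.comp (φ x) ?_ (hφ.mdifferentiableAt_symm hx)
    rwa [φ.left_inv hx]
  have h1 := mfderiv_comp x hf' (hφ.mdifferentiableAt hx)
  rw [← hev.mfderiv_eq, mfderiv_eq_fderiv] at h1
  ext v
  exact congrArg (fun A => A v) h1

/-- Needed to transport the Cauchy–Riemann equations: every tangent vector of $\mathbb C^n$ is then
of the form `dφ v`, on which multiplication by $i$ comes from `𝓘`. -/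
theorem surjective_mvfderiv (hφ : IsHolomorphicChart 𝓘 φ) {x : X} (hx : x ∈ φ.source) :
    Function.Surjective (mvfderiv 𝓜 φ x) := by
  obtain ⟨y, hy, rfl⟩ : ∃ y ∈ φ.target, φ.symm y = x := ⟨φ x, φ.map_source hx, φ.left_inv hx⟩
  intro w
  have hev : (φ ∘ φ.symm : (Fin n → ℂ) → Fin n → ℂ) =ᶠ[nhds y] id := by
    filter_upwards [φ.open_target.mem_nhds hy] with y hy
    simp [φ.right_inv hy]
  have hs := hφ.mdifferentiableAt_symm hx
  rw [φ.right_inv hy] at hs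
  have h1 := mfderiv_comp y (hφ.mdifferentiableAt hx) hs
  rw [hev.mfderiv_eq, mfderiv_id] at h1
  exact ⟨mfderiv 𝓘(ℝ, Fin n → ℂ) 𝓜 φ.symm y w, (congrArg (fun A => A w) h1).symm⟩

theorem differentiableOn_comp_symm (hφ : IsHolomorphicChart 𝓘 φ) {f : X → ℂ} {U : Set X}
    (hU : IsOpen U) (hf : IsHolomorphicOn 𝓘 f U) :
    DifferentiableOn ℂ (f ∘ φ.symm) (φ.target ∩ φ.symm ⁻¹' U) := by
  intro w hw
  have hsm := (hφ.contDiffOn_comp_symm hf.1).contDiffAt ((isOpen_preimage φ hU).mem_nhds hw)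
  refine (differentiableAt_complex_of_fderiv_I_smul (hsm.differentiableAt (by simp))
    fun v => ?_).differentiableWithinAt
  obtain ⟨x, hx, rfl⟩ : ∃ x ∈ φ.source, φ x = w := ⟨φ.symm w, φ.map_target hw.1, φ.right_inv hw.1⟩
  have hxU : x ∈ U := by simpa [φ.left_inv hx] using hw.2
  obtain ⟨v, rfl⟩ := hφ.surjective_mvfderiv hx v
  have hm := hφ.mvfderiv_eq hx
    ((hf.1.contMDiffAt (hU.mem_nhds hxU)).mdifferentiableAt (by simp))
  have := hf.2 x hxU v
  rw [hm] at this
  simpa [hφ.complexLinear x hx] using this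

end IsHolomorphicChart

/-- In the holomorphic chart `φ`, the bivector field `P` is the product of the constant bivector
`B` and the holomorphic function `u`, which is a Casimir function of `B`. -/
structure IsPoissonChart (𝓘 : ∀ x : X, TangentSpace 𝓜 x →L[ℝ] TangentSpace 𝓜 x)
    (P : ∀ x : X, CBivector (TangentSpace 𝓜 x)) (φ : OpenPartialHomeomorph X (Fin n → ℂ))
    (u : (Fin n → ℂ) → ℂ) (B : CBivector (Fin n → ℂ)) : Prop extends IsHolomorphicChart 𝓘 φ where
  apply_comp : ∀ x ∈ φ.source, ∀ α β : (Fin n → ℂ) →L[ℝ] ℂ,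
    P x ![α.comp (mvfderiv 𝓜 φ x), β.comp (mvfderiv 𝓜 φ x)] = u (φ x) * B ![α, β]
  differentiable : Differentiable ℂ u
  contDiff : ContDiff ℝ ∞ u
  casimir : ∀ w α, B ![α, fderiv ℝ u w] = 0

namespace IsPoissonChart

variable {u : (Fin n → ℂ) → ℂ} {B : CBivector (Fin n → ℂ)}

theorem bracket_eq (hP : IsPoissonChart 𝓘 P φ u B) {f g : X → ℂ} {x : X} (hx : x ∈ φ.source)
    (hf : MDifferentiableAt 𝓜 𝓘(ℝ, ℂ) f x) (hg : MDifferentiableAt 𝓜 𝓘(ℝ, ℂ) g x) :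
    bivectorBracket P f g x = modelBracket u B (f ∘ φ.symm) (g ∘ φ.symm) (φ x) := by
  rw [bivectorBracket, hP.mvfderiv_eq hx hf, hP.mvfderiv_eq hx hg, hP.apply_comp x hx]
  rfl

theorem contMDiffAt_bracket (hP : IsPoissonChart 𝓘 P φ u B) {f g : X → ℂ} {U : Set X}
    (hU : IsOpen U) (hf : ContMDiffOn 𝓜 𝓘(ℝ, ℂ) ∞ f U) (hg : ContMDiffOn 𝓜 𝓘(ℝ, ℂ) ∞ g U)
    {x : X} (hx : x ∈ φ.source) (hxU : x ∈ U) :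
    ContMDiffAt 𝓜 𝓘(ℝ, ℂ) ∞ (bivectorBracket P f g) x := by
  have hO := IsHolomorphicChart.isOpen_preimage φ hU
  have h1 : ContMDiffAt 𝓘(ℝ, Fin n → ℂ) 𝓘(ℝ, ℂ) ∞
      (modelBracket u B (f ∘ φ.symm) (g ∘ φ.symm)) (φ x) :=
    ((ContDiffOn.modelBracket B hO hP.contDiff.contDiffOn (hP.contDiffOn_comp_symm hf)
      (hP.contDiffOn_comp_symm hg)).contDiffAt (hO.mem_nhds
        ⟨φ.map_source hx, by simpa [φ.left_inv hx] using hxU⟩)).contMDiffAt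
  refine (h1.comp x (hP.contMDiffOn.contMDiffAt (φ.open_source.mem_nhds hx))).congr_of_eventuallyEq
    ?_
  filter_upwards [φ.open_source.mem_nhds hx, hU.mem_nhds hxU] with y hy hyU
  exact hP.bracket_eq hy ((hf.contMDiffAt (hU.mem_nhds hyU)).mdifferentiableAt (by simp))
    ((hg.contMDiffAt (hU.mem_nhds hyU)).mdifferentiableAt (by simp))

theorem bracket_comp_symm (hP : IsPoissonChart 𝓘 P φ u B) {f g : X → ℂ} {U : Set X}
    (hU : IsOpen U) (hf : ContMDiffOn 𝓜 𝓘(ℝ, ℂ) ∞ f U) (hg : ContMDiffOn 𝓜 𝓘(ℝ, ℂ) ∞ g U) :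
    Set.EqOn (bivectorBracket P f g ∘ φ.symm) (modelBracket u B (f ∘ φ.symm) (g ∘ φ.symm))
      (φ.target ∩ φ.symm ⁻¹' U) := by
  intro w hw
  have hwU := hU.mem_nhds hw.2
  rw [Function.comp_apply, hP.bracket_eq (φ.map_target hw.1)
    ((hf.contMDiffAt hwU).mdifferentiableAt (by simp))
    ((hg.contMDiffAt hwU).mdifferentiableAt (by simp)), φ.right_inv hw.1]

theorem bracket_bracket_eq (hP : IsPoissonChart 𝓘 P φ u B) {f g k : X → ℂ} {U : Set X}
    (hU : IsOpen U) (hf : ContMDiffOn 𝓜 𝓘(ℝ, ℂ) ∞ f U) (hg : ContMDiffOn 𝓜 𝓘(ℝ, ℂ) ∞ g U)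
    (hk : ContMDiffOn 𝓜 𝓘(ℝ, ℂ) ∞ k U) {x : X} (hx : x ∈ φ.source) (hxU : x ∈ U) :
    bivectorBracket P f (bivectorBracket P g k) x = modelBracket u B (f ∘ φ.symm)
      (modelBracket u B (g ∘ φ.symm) (k ∘ φ.symm)) (φ x) := by
  rw [hP.bracket_eq hx ((hf.contMDiffAt (hU.mem_nhds hxU)).mdifferentiableAt (by simp))
    ((hP.contMDiffAt_bracket hU hg hk hx hxU).mdifferentiableAt (by simp))]
  have hO := (IsHolomorphicChart.isOpen_preimage φ hU).mem_nhds
    (x := φ x) ⟨φ.map_source hx, by simpa [φ.left_inv hx] using hxU⟩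
  rw [modelBracket, modelBracket,
    ((hP.bracket_comp_symm hU hg hk).eventuallyEq_of_mem hO).fderiv_eq]

theorem schoutenSelf_eq_zero (hP : IsPoissonChart 𝓘 P φ u B) {f g k : X → ℂ} {U : Set X}
    (hU : IsOpen U) (hf : ContMDiffOn 𝓜 𝓘(ℝ, ℂ) ∞ f U) (hg : ContMDiffOn 𝓜 𝓘(ℝ, ℂ) ∞ g U)
    (hk : ContMDiffOn 𝓜 𝓘(ℝ, ℂ) ∞ k U) {x : X} (hx : x ∈ φ.source) (hxU : x ∈ U) :
    schoutenSelf P f g k x = 0 := by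
  rw [schoutenSelf, hP.bracket_bracket_eq hU hf hg hk hx hxU,
    hP.bracket_bracket_eq hU hg hk hf hx hxU, hP.bracket_bracket_eq hU hk hf hg hx hxU,
    modelBracket_jacobi (IsHolomorphicChart.isOpen_preimage φ hU) hP.contDiff.contDiffOn
      (fun w _ => hP.casimir w) (hP.contDiffOn_comp_symm hf) (hP.contDiffOn_comp_symm hg)
      (hP.contDiffOn_comp_symm hk) ⟨φ.map_source hx, by simpa [φ.left_inv hx] using hxU⟩, mul_zero]

/-- Holomorphy of the bracket is obtained for arbitrary local holomorphic functions, so that it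
applies to the coordinates of any holomorphic chart, not only to those of `φ`. -/
theorem mvfderiv_bracket (hP : IsPoissonChart 𝓘 P φ u B) {f g : X → ℂ} {U : Set X}
    (hU : IsOpen U) (hf : IsHolomorphicOn 𝓘 f U) (hg : IsHolomorphicOn 𝓘 g U)
    {x : X} (hx : x ∈ φ.source) (hxU : x ∈ U) (v : TangentSpace 𝓜 x) :
    mvfderiv 𝓜 (bivectorBracket P f g) x (𝓘 x v) =
      Complex.I * mvfderiv 𝓜 (bivectorBracket P f g) x v := by
  have hO := IsHolomorphicChart.isOpen_preimage φ hU
  have hmem := hO.mem_nhds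
    (x := φ x) ⟨φ.map_source hx, by simpa [φ.left_inv hx] using hxU⟩
  have hd := ((DifferentiableOn.modelBracket_complex B hO hP.differentiable.differentiableOn
    (hP.differentiableOn_comp_symm hU hf) (hP.differentiableOn_comp_symm hU hg)
    (hP.contDiffOn_comp_symm hf.1) (hP.contDiffOn_comp_symm hg.1)).differentiableAt hmem)
  rw [hP.mvfderiv_eq hx
    ((hP.contMDiffAt_bracket hU hf.1 hg.1 hx hxU).mdifferentiableAt (by simp)),
    ((hP.bracket_comp_symm hU hf.1 hg.1).eventuallyEq_of_mem hmem).fderiv_eq,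
    hd.fderiv_restrictScalars ℝ, ContinuousLinearMap.comp_apply, hP.complexLinear x hx]
  simp

end IsPoissonChart

theorem IsHolomorphicChart.isHolomorphicOn_apply (hφ : IsHolomorphicChart 𝓘 φ) (j : Fin n) :
    IsHolomorphicOn 𝓘 (fun x => φ x j) φ.source := by
  refine ⟨fun x hx => ?_, fun x hx v => ?_⟩
  · exact ((contMDiff_iff_contDiff.2 (contDiff_apply ℝ ℂ j)).contMDiffAt).comp_contMDiffWithinAt x
      (hφ.contMDiffOn x hx)
  · have hm : MDifferentiableAt 𝓘(ℝ, Fin n → ℂ) 𝓘(ℝ, ℂ) (fun w : Fin n → ℂ => w j) (φ x) :=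
      (contMDiff_iff_contDiff.2 (contDiff_apply ℝ ℂ j)).contMDiffAt.mdifferentiableAt
        (n := ∞) (by simp)
    have h1 := mfderiv_comp x hm (hφ.mdifferentiableAt hx)
    rw [mfderiv_eq_fderiv] at h1
    have h2 : ∀ v : TangentSpace 𝓜 x, mvfderiv 𝓜 (fun x => φ x j) x v = mvfderiv 𝓜 φ x v j := by
      intro v
      refine (congrArg (fun A => A v) h1).trans ?_
      have : fderiv ℝ (fun w : Fin n → ℂ => w j) (φ x) = ContinuousLinearMap.proj j :=
        (ContinuousLinearMap.proj (R := ℝ) (φ := fun _ : Fin n => ℂ) j).fderiv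
      exact congrArg (fun A : (Fin n → ℂ) →L[ℝ] ℂ => A (mvfderiv 𝓜 φ x v)) this
    rw [h2, h2, hφ.complexLinear x hx]
    rfl

/-- A bivector field of type `(2,0)` that has, around every point, a holomorphic chart in which it
is constant up to a holomorphic Casimir function is a holomorphic Poisson structure. -/
theorem isHolomorphicPoisson_of_charts
    (hP20 : ∀ x : X, (P x).part20 (𝓘 x) = P x)
    (hP : ∀ x : X, ∃ (n : ℕ) (φ : OpenPartialHomeomorph X (Fin n → ℂ)) (u : (Fin n → ℂ) → ℂ)
      (B : CBivector (Fin n → ℂ)), x ∈ φ.source ∧ IsPoissonChart 𝓘 P φ u B) :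
    IsHolomorphicPoisson 𝓘 P where
  smooth U hU f g hf hg x hxU := by
    obtain ⟨n, φ, u, B, hx, h⟩ := hP x
    exact (h.contMDiffAt_bracket hU hf hg hx hxU).contMDiffWithinAt
  type20 := hP20
  schouten U hU f g k hf hg hk x hxU := by
    obtain ⟨n, φ, u, B, hx, h⟩ := hP x
    exact h.schoutenSelf_eq_zero hU hf hg hk hx hxU
  holomorphic n ψ hψ j k := by
    -- The coordinates of `ψ` enter only as holomorphic functions on `ψ.source`; their bracket is
    -- computed in the distinguished chart at `x`, so no transition maps are required.
    refine ⟨fun x hxU => ?_, fun x hxU v => ?_⟩ <;> obtain ⟨n, φ, u, B, hx, h⟩ := hP x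
    · exact (h.contMDiffAt_bracket ψ.open_source (hψ.isHolomorphicOn_apply j).1
        (hψ.isHolomorphicOn_apply k).1 hx hxU).contMDiffWithinAt
    · exact h.mvfderiv_bracket ψ.open_source (hψ.isHolomorphicOn_apply j)
        (hψ.isHolomorphicOn_apply k) hx hxU v

end PoissonChart

/-! ### Linear algebra -/

/-- A real vector space with a complex structure is isomorphic to `ℂⁿ`. -/
theorem exists_continuousLinearEquiv_complex {W : Type*} [NormedAddCommGroup W] [NormedSpace ℝ W]
    [FiniteDimensional ℝ W] (J : W →L[ℝ] W) (hJ : ∀ w, J (J w) = -w) :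
    ∃ (n : ℕ) (L : W ≃L[ℝ] (Fin n → ℂ)), ∀ w, L (J w) = Complex.I • L w := by
  -- An endomorphism of square $-1$ is the image of $i$ under a unique algebra map from $\mathbb C$;
  -- this makes `W` a complex vector space, and any complex basis provides `L`.
  let ρ : ℂ →ₐ[ℝ] Module.End ℝ W := Complex.lift ⟨(J : W →ₗ[ℝ] W), by
    ext w
    simp [hJ]⟩
  let _ : Module ℂ W := Module.compHom W ρ.toRingHom
  have hI : ∀ w : W, Complex.I • w = J w := fun w => by
    change ρ Complex.I w = J w
    simp [ρ]
  have : IsScalarTower ℝ ℂ W := ⟨fun r c w => by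
    change ρ (r • c) w = r • ρ c w
    rw [map_smul]
    rfl⟩
  have : FiniteDimensional ℂ W := FiniteDimensional.right ℝ ℂ W
  let L₀ : W ≃ₗ[ℂ] (Fin (Module.finrank ℂ W) → ℂ) := (Module.finBasis ℂ W).equivFun
  refine ⟨Module.finrank ℂ W, (L₀.restrictScalars ℝ).toContinuousLinearEquiv, fun w => ?_⟩
  change L₀ (J w) = Complex.I • L₀ w
  rw [← hI, map_smul]

/-- Multiplication by `i` on `ℂⁿ`. -/
noncomputable def complexI (n : ℕ) : (Fin n → ℂ) →L[ℝ] (Fin n → ℂ) :=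
  Complex.I • ContinuousLinearMap.id ℝ (Fin n → ℂ)

theorem covector10_apply {V : Type*} [AddCommGroup V] [Module ℝ V] [TopologicalSpace V]
    (J : V →L[ℝ] V) (α : V →L[ℝ] ℂ) (v : V) :
    covector10 J α v = 1 / 2 * (α v - Complex.I * α (J v)) := by
  simp [covector10]

theorem covector10_comp {V W : Type*} [AddCommGroup V] [Module ℝ V] [TopologicalSpace V]
    [AddCommGroup W] [Module ℝ W] [TopologicalSpace W] {J : V →L[ℝ] V} {J' : W →L[ℝ] W}
    {A : V →L[ℝ] W} (hA : ∀ v, A (J v) = J' (A v)) (α : W →L[ℝ] ℂ) :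
    covector10 J (α.comp A) = (covector10 J' α).comp A := by
  ext v
  simp [covector10_apply, hA]

theorem covector10_apply_map {V : Type*} [AddCommGroup V] [Module ℝ V] [TopologicalSpace V]
    {J : V →L[ℝ] V} (hJ : ∀ v, J (J v) = -v) (α : V →L[ℝ] ℂ) (v : V) :
    covector10 J α (J v) = Complex.I * covector10 J α v := by
  simp only [covector10_apply, hJ, map_neg]
  linear_combination (1 / 2 * α (J v)) * Complex.I_mul_I

theorem covector10_idem {V : Type*} [AddCommGroup V] [Module ℝ V] [TopologicalSpace V]
    {J : V →L[ℝ] V} (hJ : ∀ v, J (J v) = -v) (α : V →L[ℝ] ℂ) :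
    covector10 J (covector10 J α) = covector10 J α := by
  ext v
  rw [covector10_apply, covector10_apply_map hJ]
  linear_combination (-1 / 2 * covector10 J α v) * Complex.I_mul_I

theorem CBivector.compLinearMap_apply_pair {V W : Type*} [AddCommGroup V] [Module ℝ V]
    [TopologicalSpace V] [AddCommGroup W] [Module ℝ W] [TopologicalSpace W] (P : CBivector V)
    (A : (W →L[ℝ] ℂ) →ₗ[ℂ] (V →L[ℝ] ℂ)) (α β : W →L[ℝ] ℂ) :
    P.compLinearMap A ![α, β] = P ![A α, A β] := by
  rw [AlternatingMap.compLinearMap_apply]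
  congr 1
  ext i
  fin_cases i <;> rfl

theorem CBivector.part20_apply {V : Type*} [AddCommGroup V] [Module ℝ V] [TopologicalSpace V]
    (J : V →L[ℝ] V) (P : CBivector V) (α β : V →L[ℝ] ℂ) :
    P.part20 J ![α, β] = P ![covector10 J α, covector10 J β] :=
  P.compLinearMap_apply_pair _ _ _

theorem CBivector.pushforward_apply {V W : Type*} [AddCommGroup V] [Module ℝ V]
    [TopologicalSpace V] [AddCommGroup W] [Module ℝ W] [TopologicalSpace W] (A : V →L[ℝ] W)
    (P : CBivector V) (α β : W →L[ℝ] ℂ) :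
    P.pushforward A ![α, β] = P ![α.comp A, β.comp A] :=
  P.compLinearMap_apply_pair _ _ _

theorem CBivector.part20_part20 {V : Type*} [AddCommGroup V] [Module ℝ V] [TopologicalSpace V]
    {J : V →L[ℝ] V} (hJ : ∀ v, J (J v) = -v) (P : CBivector V) :
    (P.part20 J).part20 J = P.part20 J := by
  ext α
  simp only [CBivector.part20, AlternatingMap.compLinearMap_apply]
  congr 1
  ext i
  simp only [covector10_idem hJ]

theorem CBivector.part20_smul {V : Type*} [AddCommGroup V] [Module ℝ V] [TopologicalSpace V]
    (J : V →L[ℝ] V) (c : ℂ) (P : CBivector V) : (c • P).part20 J = c • P.part20 J := rfl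

/-! ### The shear that straightens the complex structures, and its effect on $P_I$ -/

namespace LinearHyperkahler

variable {E : Type*} [NormedAddCommGroup E] [InnerProductSpace ℝ E] (h : LinearHyperkahler E)

theorem J_I (v : E) : h.J (h.I v) = -h.I (h.J v) := by rw [h.anticomm, neg_neg]

theorem sphere_sq_add_sq (a : TwoSphere) : a.1 0 ^ 2 + a.1 1 ^ 2 + a.1 2 ^ 2 = 1 := by
  have := EuclideanSpace.norm_sq_eq a.1
  simp only [norm_eq_of_mem_sphere, Fin.sum_univ_three, Real.norm_eq_abs, sq_abs] at this
  linarith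

theorem structureAt_apply (a : TwoSphere) (v : E) :
    h.structureAt a v = a.1 0 • h.I v + a.1 1 • h.J v + a.1 2 • h.I (h.J v) := rfl

theorem structureAt_sq (a : TwoSphere) (v : E) : h.structureAt a (h.structureAt a v) = -v := by
  have hs := sphere_sq_add_sq a
  simp only [structureAt_apply, map_add, map_smul, h.I_sq, h.J_sq, h.J_I, map_neg]
  match_scalars <;> first | ring1 | linear_combination -hs

/-- The isomorphism `v ↦ v - l ε J v` from `(E, I_𝐚)` to `(E, -εI)`, where `l` is the stereographic
coordinate of `𝐚` and `ε = ±1`. -/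
def shear (ε : ℝ) (l : ℂ) : E →L[ℝ] E :=
  ContinuousLinearMap.id ℝ E - (ε * l.re) • h.J + l.im • h.K

theorem shear_apply (ε : ℝ) (l : ℂ) (v : E) :
    h.shear ε l v = v - (ε * l.re) • h.J v + l.im • h.I (h.J v) := rfl

theorem shear_zero (ε : ℝ) : h.shear ε 0 = ContinuousLinearMap.id ℝ E := by
  ext v
  simp [shear_apply]

/-- Write the shear as $1-T$ with $T=\varepsilon\,\mathrm{Re}(l)J-\mathrm{Im}(l)K$. As $J$ and $K$
anticommute, $T^2=-|l|^2$, so $(1+T)(1-T)=1+|l|^2$. This gives the inverse of the shear. -/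
theorem shear_neg_shear {ε : ℝ} (hε : ε ^ 2 = 1) (l : ℂ) (v : E) :
    h.shear ε (-l) (h.shear ε l v) = (1 + Complex.normSq l) • v := by
  simp only [shear_apply, map_add, map_sub, map_smul, h.I_sq, h.J_sq, h.J_I, map_neg,
    Complex.neg_re, Complex.neg_im, Complex.normSq_apply]
  match_scalars <;> first | ring1 | linear_combination (l.re ^ 2) * hε

/-- The stereographic coordinate `(c + iεb) / (1 - εa)` of `𝐚 = (a, b, c)`. -/
noncomputable def _root_.TwoSphere.stereo (ε : ℝ) (a : TwoSphere) : ℂ :=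
  ⟨a.1 2, ε * a.1 1⟩ / ((1 - ε * a.1 0 : ℝ) : ℂ)

theorem _root_.TwoSphere.stereo_re (ε : ℝ) (a : TwoSphere) :
    (TwoSphere.stereo ε a).re = a.1 2 / (1 - ε * a.1 0) := by
  rw [TwoSphere.stereo, Complex.div_ofReal_re]

theorem _root_.TwoSphere.stereo_im (ε : ℝ) (a : TwoSphere) :
    (TwoSphere.stereo ε a).im = ε * a.1 1 / (1 - ε * a.1 0) := by
  rw [TwoSphere.stereo, Complex.div_ofReal_im]

theorem shear_structureAt {ε : ℝ} (hε : ε ^ 2 = 1) {a : TwoSphere} (ha : ε * a.1 0 ≠ 1) (v : E) :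
    h.shear ε (TwoSphere.stereo ε a) (h.structureAt a v) =
      -(ε • h.I (h.shear ε (TwoSphere.stereo ε a) v)) := by
  have hs := sphere_sq_add_sq a
  have hd : 1 - ε * a.1 0 ≠ 0 := fun e => ha (by linarith)
  simp only [structureAt_apply, shear_apply, map_add, map_sub, map_smul, h.I_sq, h.J_sq, h.J_I,
    map_neg]
  have hx : (TwoSphere.stereo ε a).re * (1 - ε * a.1 0) = a.1 2 := by
    rw [TwoSphere.stereo_re, div_mul_cancel₀ _ hd]
  have hy : (TwoSphere.stereo ε a).im * (1 - ε * a.1 0) = ε * a.1 1 := by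
    rw [TwoSphere.stereo_im, div_mul_cancel₀ _ hd]
  generalize (TwoSphere.stereo ε a).re = x at *
  generalize (TwoSphere.stereo ε a).im = y at *
  -- This is the sphere equation $b^2+c^2=(1-\varepsilon a)(1+\varepsilon a)$ divided by
  -- $1-\varepsilon a$. With `hx` and `hy` it settles the coefficients of $v$, $Iv$, $Jv$ and $IJv$.
  have hxy : x * a.1 2 + ε * y * a.1 1 = 1 + ε * a.1 0 := by
    refine mul_right_cancel₀ hd ?_
    linear_combination a.1 2 * hx + ε * a.1 1 * hy + hs + (a.1 1 ^ 2 + a.1 0 ^ 2) * hε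
  generalize a.1 0 = p at *
  generalize a.1 1 = q at *
  generalize a.1 2 = r at *
  match_scalars
  · linear_combination -ε * hxy + (q * y - p) * hε
  · linear_combination -hx - x * hε
  · linear_combination -ε * hy - (p * y + q) * hε
  · linear_combination -x * hy + y * hx

variable [CompleteSpace E]

theorem formInv_comp_I (α : E →L[ℝ] ℝ) :
    h.formInv (α.comp h.I) = -(InnerProductSpace.toDual ℝ E).symm α := by
  have : (InnerProductSpace.toDual ℝ E).symm (α.comp h.I) =
      -h.I ((InnerProductSpace.toDual ℝ E).symm α) := by
    refine ext_inner_right ℝ fun v => ?_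
    rw [InnerProductSpace.toDual_symm_apply, ContinuousLinearMap.comp_apply, inner_neg_left,
      ← h.inner_I, h.I_sq, inner_neg_left, neg_neg, InnerProductSpace.toDual_symm_apply]
  rw [formInv, this, map_neg, h.I_sq, neg_neg]

theorem apply_formInv_comp_I (α β : E →L[ℝ] ℝ) :
    β.comp h.I (h.formInv (α.comp h.I)) = β (h.formInv α) := by
  rw [formInv_comp_I, ContinuousLinearMap.comp_apply, map_neg]
  rfl

theorem bivector_comp_I (α β : E →L[ℝ] ℂ) :
    h.bivector ![α.comp h.I, β.comp h.I] = h.bivector ![α, β] := by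
  have key := h.apply_formInv_comp_I
  apply Complex.ext
  · exact congrArg₂ (· - ·) (key (Complex.reCLM.comp α) (Complex.reCLM.comp β))
      (key (Complex.imCLM.comp α) (Complex.imCLM.comp β))
  · exact congrArg₂ (· + ·) (key (Complex.reCLM.comp α) (Complex.imCLM.comp β))
      (key (Complex.imCLM.comp α) (Complex.reCLM.comp β))

/-- The bivector `P_I` has type `(1,1)` with respect to `I`. -/
theorem bivector_eq_zero {ε : ℝ} (hε : ε ^ 2 = 1) {α β : E →L[ℝ] ℂ}
    (hα : ∀ v, α (h.I v) = ε * Complex.I * α v) (hβ : ∀ v, β (h.I v) = ε * Complex.I * β v) :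
    h.bivector ![α, β] = 0 := by
  have e1 : α.comp h.I = ((ε : ℂ) * Complex.I) • α := by ext v; exact hα v
  have e2 : β.comp h.I = ((ε : ℂ) * Complex.I) • β := by ext v; exact hβ v
  have := h.bivector_comp_I α β
  -- Invariance under $I$ now reads $P=(\varepsilon i)^2P=-P$.
  rw [e1, e2, CBivector.smul_left, CBivector.smul_right] at this
  have hε' : (ε : ℂ) ^ 2 = 1 := by exact_mod_cast hε
  linear_combination (-1 / 2 : ℂ) * this + (1 / 2 * Complex.I ^ 2 * h.bivector ![α, β]) * hε' +
    (1 / 2 * h.bivector ![α, β]) * Complex.I_sq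

/-- The central computation. Expanding $P_I(\alpha-\varepsilon l\,\alpha J,\ \beta-\varepsilon
l\,\beta J)$, the terms of degree 0 and 2 in $l$ pair covectors of equal type and vanish by
`bivector_eq_zero`. What remains is linear in $l$, so it is $l$ times the negative of its value at
$l=-1$. -/
theorem bivector_comp_shear {ε : ℝ} (hε : ε ^ 2 = 1) (l : ℂ) {α β : E →L[ℝ] ℂ}
    (hα : ∀ v, α (-(ε • h.I v)) = Complex.I * α v) (hβ : ∀ v, β (-(ε • h.I v)) = Complex.I * β v) :
    h.bivector ![α.comp (h.shear ε l), β.comp (h.shear ε l)] =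
      l * -h.bivector ![α.comp (h.shear ε (-1)), β.comp (h.shear ε (-1))] := by
  have hε' : (ε : ℂ) ^ 2 = 1 := by exact_mod_cast hε
  have hI : ∀ {γ : E →L[ℝ] ℂ}, (∀ v, γ (-(ε • h.I v)) = Complex.I * γ v) →
      ∀ v, γ (h.I v) = ((-ε : ℝ) : ℂ) * Complex.I * γ v := by
    intro γ hγ v
    have := hγ v
    rw [map_neg, map_smul, Complex.real_smul] at this
    push_cast
    linear_combination (-(ε : ℂ)) * this - γ (h.I v) * hε'
  -- Since $J$ anticommutes with $I$, composition with $J$ exchanges the types $(1,0)$ and $(0,1)$.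
  have hIJ : ∀ {γ : E →L[ℝ] ℂ}, (∀ v, γ (-(ε • h.I v)) = Complex.I * γ v) →
      ∀ v, γ.comp h.J (h.I v) = (ε : ℂ) * Complex.I * γ.comp h.J v := by
    intro γ hγ v
    rw [ContinuousLinearMap.comp_apply, ContinuousLinearMap.comp_apply, h.J_I, map_neg, hI hγ]
    push_cast
    ring
  -- On a covector of type $(1,0)$ for $-\varepsilon I$, the real and imaginary coefficients of the
  -- shear combine into multiplication by the complex number `m`.
  have hsh : ∀ {γ : E →L[ℝ] ℂ}, (∀ v, γ (-(ε • h.I v)) = Complex.I * γ v) → ∀ m : ℂ,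
      γ.comp (h.shear ε m) = γ + (-(ε * m)) • γ.comp h.J := by
    intro γ hγ m
    ext v
    simp only [ContinuousLinearMap.comp_apply, shear_apply, map_add, map_sub, map_smul, hI hγ,
      add_apply, smul_apply, smul_eq_mul,
      Complex.real_smul]
    push_cast
    linear_combination (-(ε : ℂ) * γ (h.J v)) * Complex.re_add_im m
  rw [hsh hα, hsh hβ, hsh hα, hsh hβ]
  simp only [CBivector.add_left, CBivector.add_right, CBivector.smul_left, CBivector.smul_right]
  rw [h.bivector_eq_zero (ε := -ε) (by simpa using hε) (hI hα) (hI hβ),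
    h.bivector_eq_zero hε (hIJ hα) (hIJ hβ)]
  ring

end LinearHyperkahler

/-! ### Stereographic coordinates -/

namespace TwoSphere

/-- The differential of the inclusion `S² → ℝ³`. -/
noncomputable def inclDeriv (a : TwoSphere) : TangentSpace (𝓡 2) a →L[ℝ] EuclideanSpace ℝ (Fin 3) :=
  mvfderiv (𝓡 2) ((↑) : TwoSphere → EuclideanSpace ℝ (Fin 3)) a

theorem inclDeriv_dot (a : TwoSphere) (v : TangentSpace (𝓡 2) a) :
    a.1 0 * inclDeriv a v 0 + a.1 1 * inclDeriv a v 1 + a.1 2 * inclDeriv a v 2 = 0 := by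
  have := (Submodule.mem_orthogonal_singleton_iff_inner_right).1 (tangentEquiv a v).2
  rw [PiLp.inner_apply, Fin.sum_univ_three] at this
  change inner ℝ (a.1 0) (inclDeriv a v 0) + inner ℝ (a.1 1) (inclDeriv a v 1) +
    inner ℝ (a.1 2) (inclDeriv a v 2) = 0 at this
  simp only [RCLike.inner_apply, conj_trivial] at this
  linear_combination this

theorem inclDeriv_complexStructure (a : TwoSphere) (v : TangentSpace (𝓡 2) a) :
    inclDeriv a (complexStructure a v) 0 = a.1 1 * inclDeriv a v 2 - a.1 2 * inclDeriv a v 1 ∧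
    inclDeriv a (complexStructure a v) 1 = a.1 2 * inclDeriv a v 0 - a.1 0 * inclDeriv a v 2 ∧
    inclDeriv a (complexStructure a v) 2 = a.1 0 * inclDeriv a v 1 - a.1 1 * inclDeriv a v 0 := by
  have := mvfderiv_complexStructure a v
  rw [cross_apply] at this
  exact ⟨congrFun this 0, congrFun this 1, congrFun this 2⟩

/-- After the injective inclusion into $\mathbb R^3$ this is ${\bf a}\times({\bf a}\times v)=-v$ for
a unit vector ${\bf a}$ orthogonal to $v$. -/
theorem complexStructure_sq (a : TwoSphere) (v : TangentSpace (𝓡 2) a) :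
    complexStructure a (complexStructure a v) = -v := by
  refine injective_mvfderiv_subtypeVal_sphere a ?_
  change inclDeriv a _ = inclDeriv a _
  have hs := LinearHyperkahler.sphere_sq_add_sq a
  have hd := inclDeriv_dot a v
  obtain ⟨h0, h1, h2⟩ := inclDeriv_complexStructure a v
  obtain ⟨k0, k1, k2⟩ := inclDeriv_complexStructure a (complexStructure a v)
  rw [h0, h1, h2] at *
  rw [map_neg]
  ext i
  fin_cases i
  · change inclDeriv a _ 0 = -(inclDeriv a v 0)
    linear_combination k0 + a.1 0 * hd - inclDeriv a v 0 * hs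
  · change inclDeriv a _ 1 = -(inclDeriv a v 1)
    linear_combination k1 + a.1 1 * hd - inclDeriv a v 1 * hs
  · change inclDeriv a _ 2 = -(inclDeriv a v 2)
    linear_combination k2 + a.1 2 * hd - inclDeriv a v 2 * hs

/-- The numerator of the stereographic coordinate. -/
noncomputable def stereoNum (ε : ℝ) : EuclideanSpace ℝ (Fin 3) →L[ℝ] ℂ :=
  Complex.ofRealCLM.comp (EuclideanSpace.proj 2) +
    (ε * Complex.I) • Complex.ofRealCLM.comp (EuclideanSpace.proj 1)

theorem stereoNum_apply (ε : ℝ) (p : EuclideanSpace ℝ (Fin 3)) :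
    stereoNum ε p = p 2 + ε * Complex.I * p 1 := rfl

/-- The stereographic projection on the ambient space. -/
noncomputable def stereoAmbient (ε : ℝ) (p : EuclideanSpace ℝ (Fin 3)) : ℂ :=
  stereoNum ε p / ((1 - ε * p 0 : ℝ) : ℂ)

theorem stereo_eq_ambient (ε : ℝ) (a : TwoSphere) : stereo ε a = stereoAmbient ε a := by
  rw [stereo, stereoAmbient, stereoNum_apply]
  congr 1
  apply Complex.ext <;> simp

theorem contDiffAt_stereoAmbient {ε : ℝ} {p : EuclideanSpace ℝ (Fin 3)} (hp : ε * p 0 ≠ 1) :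
    ContDiffAt ℝ ∞ (stereoAmbient ε) p := by
  have hd : ((1 - ε * p 0 : ℝ) : ℂ) ≠ 0 :=
    Complex.ofReal_ne_zero.2 fun e => hp (by linarith)
  have h0 : ContDiff ℝ ∞ fun p : EuclideanSpace ℝ (Fin 3) => ((1 - ε * p 0 : ℝ) : ℂ) :=
    Complex.ofRealCLM.contDiff.comp (contDiff_const.sub (contDiff_const.mul
      (EuclideanSpace.proj (𝕜 := ℝ) (0 : Fin 3)).contDiff))
  exact ((stereoNum ε).contDiff.contDiffAt.mul (h0.contDiffAt.inv hd)).congr_of_eventuallyEq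
    (Filter.Eventually.of_forall fun q => div_eq_mul_inv _ _)

/-- The identity `stereoAmbient ε q * (1 - ε * q 0) = stereoNum ε q` is differentiated at `p`; this
avoids the quotient rule and leaves no denominators. -/
theorem fderiv_stereoAmbient {ε : ℝ} {p : EuclideanSpace ℝ (Fin 3)} (hp : ε * p 0 ≠ 1)
    (v : EuclideanSpace ℝ (Fin 3)) :
    fderiv ℝ (stereoAmbient ε) p v * ((1 - ε * p 0 : ℝ) : ℂ) =
      stereoNum ε v + stereoAmbient ε p * (ε * v 0) := by
  have hden : HasFDerivAt (fun p : EuclideanSpace ℝ (Fin 3) => ((1 - ε * p 0 : ℝ) : ℂ))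
      (Complex.ofRealCLM.comp (-(ε • EuclideanSpace.proj (𝕜 := ℝ) (0 : Fin 3)))) p :=
    Complex.ofRealCLM.hasFDerivAt.comp p
      (((EuclideanSpace.proj (𝕜 := ℝ) (0 : Fin 3)).hasFDerivAt.const_mul ε).const_sub 1)
  have h1 := (((contDiffAt_stereoAmbient hp).differentiableAt (by simp)).hasFDerivAt).mul hden
  have h2 : (stereoAmbient ε * fun p : EuclideanSpace ℝ (Fin 3) => ((1 - ε * p 0 : ℝ) : ℂ))
      =ᶠ[nhds p] stereoNum ε := by
    have hc : ContinuousAt (fun p : EuclideanSpace ℝ (Fin 3) => ε * p 0) p := by fun_prop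
    filter_upwards [hc.eventually_ne hp] with q hq
    have hd : ((1 - ε * q 0 : ℝ) : ℂ) ≠ 0 :=
      Complex.ofReal_ne_zero.2 fun e => hq (by linarith)
    rw [Pi.mul_apply, stereoAmbient, div_mul_cancel₀ _ hd]
  have h3 := (h1.congr_of_eventuallyEq h2.symm).unique (stereoNum ε).hasFDerivAt
  have h4 := congrArg (fun A => A v) h3
  simp only [add_apply, smul_apply, smul_eq_mul, ContinuousLinearMap.comp_apply, neg_apply,
    Complex.ofRealCLM_apply, PiLp.proj_apply] at h4
  push_cast at h4 ⊢
  linear_combination h4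

theorem contMDiffAt_stereo {ε : ℝ} {a : TwoSphere} (ha : ε * a.1 0 ≠ 1) :
    ContMDiffAt (𝓡 2) 𝓘(ℝ, ℂ) ∞ (stereo ε) a := by
  have h1 : ContMDiffAt (𝓡 2) 𝓘(ℝ, ℂ) ∞
      (stereoAmbient ε ∘ ((↑) : TwoSphere → EuclideanSpace ℝ (Fin 3))) a :=
    (contDiffAt_stereoAmbient ha).contMDiffAt.comp a (contMDiff_coe_sphere a)
  exact h1.congr_of_eventuallyEq (Filter.Eventually.of_forall (stereo_eq_ambient ε))

theorem mvfderiv_stereo {ε : ℝ} {a : TwoSphere} (ha : ε * a.1 0 ≠ 1) (v : TangentSpace (𝓡 2) a) :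
    mvfderiv (𝓡 2) (stereo ε) a v = fderiv ℝ (stereoAmbient ε) a (inclDeriv a v) := by
  have h1 := mfderiv_comp a (((contDiffAt_stereoAmbient ha).contMDiffAt).mdifferentiableAt
    (by simp)) ((contMDiff_coe_sphere (m := ∞) (n := 2) a).mdifferentiableAt (by simp))
  have h2 : stereo ε = stereoAmbient ε ∘ ((↑) : TwoSphere → EuclideanSpace ℝ (Fin 3)) :=
    funext (stereo_eq_ambient ε)
  rw [← h2, mfderiv_eq_fderiv] at h1
  exact congrArg (fun A => A v) h1

/-- The stereographic coordinate is holomorphic. -/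
theorem mvfderiv_stereo_complexStructure {ε : ℝ} (hε : ε ^ 2 = 1) {a : TwoSphere}
    (ha : ε * a.1 0 ≠ 1) (v : TangentSpace (𝓡 2) a) :
    mvfderiv (𝓡 2) (stereo ε) a (complexStructure a v) =
      Complex.I * mvfderiv (𝓡 2) (stereo ε) a v := by
  have hd : ((1 - ε * a.1 0 : ℝ) : ℂ) ≠ 0 :=
    Complex.ofReal_ne_zero.2 fun e => ha (by linarith)
  have hst : stereoAmbient ε a * ((1 - ε * a.1 0 : ℝ) : ℂ) = stereoNum ε a :=
    div_mul_cancel₀ _ hd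
  rw [mvfderiv_stereo ha, mvfderiv_stereo ha]
  -- One factor $1-\varepsilon a$ clears the denominator of the derivative, the other that of the
  -- stereographic value still contained in it.
  refine mul_right_cancel₀ (mul_ne_zero hd hd) ?_
  have e1 := fderiv_stereoAmbient ha (inclDeriv a v)
  have e2 := fderiv_stereoAmbient ha (inclDeriv a (complexStructure a v))
  obtain ⟨h0, h1, h2⟩ := inclDeriv_complexStructure a v
  have hs : ((a.1 0 ^ 2 + a.1 1 ^ 2 + a.1 2 ^ 2 : ℝ) : ℂ) = 1 := by
    rw [LinearHyperkahler.sphere_sq_add_sq a, Complex.ofReal_one]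
  have hdot := congrArg ((↑) : ℝ → ℂ) (inclDeriv_dot a v)
  have hε' : (ε : ℂ) ^ 2 = 1 := by exact_mod_cast hε
  rw [stereoNum_apply] at e1 e2 hst
  rw [h0, h1, h2] at e2
  push_cast at e1 e2 hst hs hdot ⊢
  generalize (inclDeriv a v 0 : ℂ) = V0 at *
  generalize (inclDeriv a v 1 : ℂ) = V1 at *
  generalize (inclDeriv a v 2 : ℂ) = V2 at *
  generalize (a.1 0 : ℂ) = a0 at *
  generalize (a.1 1 : ℂ) = a1 at *
  generalize (a.1 2 : ℂ) = a2 at *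
  linear_combination (1 - ε * a0) * e2 - Complex.I * (1 - ε * a0) * e1 +
    (ε * (a1 * V2 - a2 * V1) - Complex.I * ε * V0) * hst +
    (a1 * V0 - a0 * V1 + Complex.I * V2) * hε' +
    (-ε * V1 + Complex.I * ε ^ 2 * V2) * hs + (ε * a1 - Complex.I * ε ^ 2 * a2) * hdot -
    ((1 - ε * a0) * ε * V1 + ε ^ 2 * a1 * V0) * Complex.I_sq

/-- The inverse of the stereographic projection, with values in the ambient space. -/
noncomputable def stereoInvAmbient (ε : ℝ) (l : ℂ) : EuclideanSpace ℝ (Fin 3) :=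
  (1 + Complex.normSq l)⁻¹ • !₂[ε * (Complex.normSq l - 1), 2 * ε * l.im, 2 * l.re]

theorem one_add_normSq_pos (l : ℂ) : 0 < 1 + Complex.normSq l := by
  have := Complex.normSq_nonneg l
  linarith

theorem stereoInvAmbient_mem {ε : ℝ} (hε : ε ^ 2 = 1) (l : ℂ) :
    stereoInvAmbient ε l ∈ Metric.sphere (0 : EuclideanSpace ℝ (Fin 3)) 1 := by
  have hp := (one_add_normSq_pos l).ne'
  rw [mem_sphere_zero_iff_norm, ← sq_eq_sq₀ (norm_nonneg _) zero_le_one,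
    EuclideanSpace.norm_sq_eq, Fin.sum_univ_three]
  simp only [stereoInvAmbient, PiLp.smul_apply, smul_eq_mul, Real.norm_eq_abs, sq_abs,
    Matrix.cons_val, mul_pow, inv_pow]
  rw [← mul_add, ← mul_add, one_pow, inv_mul_eq_one₀ (pow_ne_zero 2 hp), Complex.normSq_apply]
  simp only [hε]
  ring

/-- The inverse of the stereographic projection. -/
noncomputable def stereoInv {ε : ℝ} (hε : ε ^ 2 = 1) : ℂ → TwoSphere :=
  Set.codRestrict (stereoInvAmbient ε) _ (stereoInvAmbient_mem hε)

theorem contDiff_normSq : ContDiff ℝ ∞ (fun l : ℂ => Complex.normSq l) := by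
  simp only [Complex.normSq_apply]
  exact (Complex.reCLM.contDiff.mul Complex.reCLM.contDiff).add
    (Complex.imCLM.contDiff.mul Complex.imCLM.contDiff)

theorem contMDiff_stereoInv {ε : ℝ} (hε : ε ^ 2 = 1) :
    ContMDiff 𝓘(ℝ, ℂ) (𝓡 2) ∞ (stereoInv hε) := by
  refine ContMDiff.codRestrict_sphere (contMDiff_iff_contDiff.2 ?_) _
  refine ((contDiff_const.add contDiff_normSq).inv fun l => (one_add_normSq_pos l).ne').smul ?_
  rw [contDiff_piLp]
  intro i
  fin_cases i
  · exact contDiff_const.mul (contDiff_normSq.sub contDiff_const)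
  · exact contDiff_const.mul Complex.imCLM.contDiff
  · exact contDiff_const.mul Complex.reCLM.contDiff

theorem stereoInv_apply {ε : ℝ} (hε : ε ^ 2 = 1) (l : ℂ) :
    (stereoInv hε l).1 0 = (1 + Complex.normSq l)⁻¹ * (ε * (Complex.normSq l - 1)) ∧
    (stereoInv hε l).1 1 = (1 + Complex.normSq l)⁻¹ * (2 * ε * l.im) ∧
    (stereoInv hε l).1 2 = (1 + Complex.normSq l)⁻¹ * (2 * l.re) := ⟨rfl, rfl, rfl⟩

theorem one_sub_stereoInv {ε : ℝ} (hε : ε ^ 2 = 1) (l : ℂ) :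
    1 - ε * (stereoInv hε l).1 0 = (1 + Complex.normSq l)⁻¹ * 2 := by
  have hp := (one_add_normSq_pos l).ne'
  rw [(stereoInv_apply hε l).1]
  field_simp
  linear_combination (1 - Complex.normSq l) * hε

theorem stereo_stereoInv {ε : ℝ} (hε : ε ^ 2 = 1) (l : ℂ) : stereo ε (stereoInv hε l) = l := by
  have hp := (one_add_normSq_pos l).ne'
  apply Complex.ext
  · rw [stereo_re, one_sub_stereoInv, (stereoInv_apply hε l).2.2]
    field_simp
  · rw [stereo_im, one_sub_stereoInv, (stereoInv_apply hε l).2.1]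
    field_simp
    linear_combination l.im * hε

theorem stereoInv_stereo {ε : ℝ} (hε : ε ^ 2 = 1) {a : TwoSphere} (ha : ε * a.1 0 ≠ 1) :
    stereoInv hε (stereo ε a) = a := by
  have hs := LinearHyperkahler.sphere_sq_add_sq a
  have hd : 1 - ε * a.1 0 ≠ 0 := fun e => ha (by linarith)
  have hn : Complex.normSq (stereo ε a) = (1 + ε * a.1 0) / (1 - ε * a.1 0) := by
    rw [Complex.normSq_apply, stereo_re, stereo_im]
    field_simp
    linear_combination hs + (a.1 1 ^ 2 + a.1 0 ^ 2) * hε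
  have hn' : (1 + Complex.normSq (stereo ε a))⁻¹ = (1 - ε * a.1 0) / 2 := by
    rw [hn]
    field_simp
    ring
  obtain ⟨h0, h1, h2⟩ := stereoInv_apply hε (stereo ε a)
  rw [hn', hn] at h0
  rw [hn', stereo_im] at h1
  rw [hn', stereo_re] at h2
  apply Subtype.ext
  ext i
  fin_cases i
  · refine h0.trans ?_
    change _ = a.1 0
    field_simp
    linear_combination 2 * a.1 0 * hε
  · refine h1.trans ?_
    change _ = a.1 1
    field_simp
    linear_combination a.1 1 * hε
  · refine h2.trans ?_
    change _ = a.1 2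
    field_simp

theorem isOpen_stereo_source (ε : ℝ) : IsOpen {a : TwoSphere | ε * a.1 0 ≠ 1} :=
  isOpen_ne_fun (by fun_prop) continuous_const

/-- The stereographic projection as a chart of the sphere. -/
noncomputable def stereoChart {ε : ℝ} (hε : ε ^ 2 = 1) : OpenPartialHomeomorph TwoSphere ℂ where
  toFun := stereo ε
  invFun := stereoInv hε
  source := {a | ε * a.1 0 ≠ 1}
  target := Set.univ
  map_source' _ _ := Set.mem_univ _
  map_target' l _ := fun e => by
    -- The quantity $1-\varepsilon a=2/(1+|l|^2)$ is positive, so the projection centre is never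
    -- reached.
    have h1 := one_sub_stereoInv hε l
    rw [e, sub_self] at h1
    exact (mul_pos (inv_pos.2 (one_add_normSq_pos l)) two_pos).ne h1
  left_inv' _ ha := stereoInv_stereo hε ha
  right_inv' l _ := stereo_stereoInv hε l
  open_source := isOpen_stereo_source ε
  open_target := isOpen_univ
  continuousOn_toFun _ ha := (contMDiffAt_stereo ha).continuousAt.continuousWithinAt
  continuousOn_invFun := (contMDiff_stereoInv hε).continuous.continuousOn

end TwoSphere

/-! ### The charts of the torus -/

/-- The chart is a local inverse of the projection, whose differential is the identity. Hence
structures that are constant on `E` remain constant in every preferred chart. -/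
theorem FlatTorus.hasMFDerivAt_chartAt {E : Type*} [NormedAddCommGroup E] [NormedSpace ℝ E]
    (Γ : Submodule ℤ E) [DiscreteTopology Γ] (x₀ : FlatTorus Γ) {x : FlatTorus Γ}
    (hx : x ∈ (chartAt E x₀).source) :
    HasMFDerivAt 𝓘(ℝ, E) 𝓘(ℝ, E) (chartAt E x₀) x (ContinuousLinearMap.id ℝ E) := by
  have hmk := FlatTorus.symm_eq_mk_of_mem_atlas Γ (chart_mem_atlas E x₀)
  obtain ⟨y, hy, rfl⟩ : ∃ y ∈ (chartAt E x₀).target, (QuotientAddGroup.mk y : FlatTorus Γ) = x :=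
    ⟨chartAt E x₀ x, (chartAt E x₀).map_source hx, by
      rw [← hmk, (chartAt E x₀).left_inv hx]⟩
  have hd : MDifferentiableAt 𝓘(ℝ, E) 𝓘(ℝ, E) (chartAt E x₀) (QuotientAddGroup.mk y) :=
    ((contMDiffOn_chart (n := ∞)).contMDiffAt
      ((chartAt E x₀).open_source.mem_nhds hx)).mdifferentiableAt (by simp)
  have h1 := hd.hasMFDerivAt.comp y (FlatTorus.hasMFDerivAt_mk Γ y)
  have h2 : (chartAt E x₀ ∘ (QuotientAddGroup.mk : E → FlatTorus Γ)) =ᶠ[nhds y] id := by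
    filter_upwards [(chartAt E x₀).open_target.mem_nhds hy] with v hv
    rw [Function.comp_apply, ← hmk, (chartAt E x₀).right_inv hv, id]
  have h3 := hasMFDerivAt_unique (h1.congr_of_eventuallyEq h2.symm) (hasMFDerivAt_id y)
  have h4 : mfderiv 𝓘(ℝ, E) 𝓘(ℝ, E) (chartAt E x₀) (QuotientAddGroup.mk y : FlatTorus Γ) =
    ContinuousLinearMap.id ℝ E := h3
  rw [← h4]
  exact hd.hasMFDerivAt

/-! ### Holomorphic charts of the twistor space -/

namespace LinearHyperkahler

variable {E : Type*} [NormedAddCommGroup E] [InnerProductSpace ℝ E] (h : LinearHyperkahler E)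

/-- The derivative of `shear` in its complex parameter. -/
def shearVar (ε : ℝ) (m : ℂ) (y : E) : E := -((ε * m.re) • h.J y) + m.im • h.I (h.J y)

/-- This is holomorphy of $l\mapsto$ `shear ε l y` as a map from $\mathbb C$ to $(E,-\varepsilon
I)$. -/
theorem shearVar_I_mul {ε : ℝ} (hε : ε ^ 2 = 1) (m : ℂ) (y : E) :
    h.shearVar ε (Complex.I * m) y = -(ε • h.I (h.shearVar ε m y)) := by
  simp only [shearVar, map_add, map_smul, map_neg, h.I_sq, Complex.I_mul_re, Complex.I_mul_im]
  match_scalars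
  · ring
  · linear_combination (-m.re) * hε

theorem hasFDerivAt_shear (ε : ℝ) (p : E × ℂ) :
    ∃ A : E × ℂ →L[ℝ] E × ℂ, HasFDerivAt (fun q : E × ℂ => (h.shear ε q.2 q.1, q.2)) A p ∧
      ∀ q, A q = (h.shear ε p.2 q.1 + h.shearVar ε q.2 p.1, q.2) := by
  have hf : HasFDerivAt (fun q : E × ℂ => q.1) (ContinuousLinearMap.fst ℝ E ℂ) p := hasFDerivAt_fst
  have hJ := h.J.hasFDerivAt.comp p hf
  have hK := h.K.hasFDerivAt.comp p hf
  have hre := (Complex.reCLM.hasFDerivAt.comp p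
    (hasFDerivAt_snd (𝕜 := ℝ) (E := E) (F := ℂ))).const_mul ε
  have him := Complex.imCLM.hasFDerivAt.comp p (hasFDerivAt_snd (𝕜 := ℝ) (E := E) (F := ℂ))
  refine ⟨_, ((hf.sub (hre.smul hJ)).add (him.smul hK)).prodMk hasFDerivAt_snd, fun q => ?_⟩
  refine Prod.ext ?_ rfl
  change q.1 - ((ε * p.2.re) • h.J q.1 + (ε * q.2.re) • h.J p.1) +
    (p.2.im • h.I (h.J q.1) + q.2.im • h.I (h.J p.1)) = q.1 - (ε * p.2.re) • h.J q.1 +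
      p.2.im • h.I (h.J q.1) + (-((ε * q.2.re) • h.J p.1) + q.2.im • h.I (h.J p.1))
  abel

theorem contDiff_shear (ε : ℝ) : ContDiff ℝ ∞ (fun q : E × ℂ => h.shear ε q.2 q.1) :=
  (contDiff_fst.sub ((contDiff_const.mul (Complex.reCLM.contDiff.comp contDiff_snd)).smul
    (h.J.contDiff.comp contDiff_fst))).add ((Complex.imCLM.contDiff.comp contDiff_snd).smul
      (h.K.contDiff.comp contDiff_fst))

theorem contDiff_shearInv (ε : ℝ) : ContDiff ℝ ∞
    (fun q : E × ℂ => (1 + Complex.normSq q.2)⁻¹ • h.shear ε (-q.2) q.1) := by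
  have h1 : ContDiff ℝ ∞ fun q : E × ℂ => 1 + Complex.normSq q.2 :=
    contDiff_const.add (TwoSphere.contDiff_normSq.comp contDiff_snd)
  have h3 : ContDiff ℝ ∞ fun q : E × ℂ => h.shear ε (-q.2) q.1 :=
    (contDiff_fst.sub ((contDiff_const.mul (Complex.reCLM.contDiff.comp contDiff_snd.neg)).smul
      (h.J.contDiff.comp contDiff_fst))).add ((Complex.imCLM.contDiff.comp contDiff_snd.neg).smul
        (h.K.contDiff.comp contDiff_fst))
  have h4 : ContDiff ℝ ∞ fun q : E × ℂ => (1 + Complex.normSq q.2)⁻¹ :=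
    h1.inv fun q => (TwoSphere.one_add_normSq_pos q.2).ne'
  exact h4.smul h3

/-- The family of maps `shear ε l` as a homeomorphism of `E × ℂ`. -/
noncomputable def shearHomeomorph {ε : ℝ} (hε : ε ^ 2 = 1) : E × ℂ ≃ₜ E × ℂ where
  toFun q := (h.shear ε q.2 q.1, q.2)
  invFun q := ((1 + Complex.normSq q.2)⁻¹ • h.shear ε (-q.2) q.1, q.2)
  left_inv q := by
    refine Prod.ext ?_ rfl
    simp only [h.shear_neg_shear hε, inv_smul_smul₀ (TwoSphere.one_add_normSq_pos q.2).ne']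
  right_inv q := by
    have := h.shear_neg_shear hε (-q.2) q.1
    rw [neg_neg, Complex.normSq_neg] at this
    refine Prod.ext ?_ rfl
    simp only [map_smul, this, inv_smul_smul₀ (TwoSphere.one_add_normSq_pos q.2).ne']
  continuous_toFun := (h.contDiff_shear ε).continuous.prodMk continuous_snd
  continuous_invFun := (h.contDiff_shearInv ε).continuous.prodMk continuous_snd

variable (Γ : Submodule ℤ E) [DiscreteTopology Γ]

theorem twistorStructure_sq (z : FlatTorus Γ × TwoSphere)
    (v : TangentSpace (𝓘(ℝ, E).prod (𝓡 2)) z) :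
    h.twistorStructure Γ z (h.twistorStructure Γ z v) = -v := by
  refine Prod.ext ?_ ?_
  · exact h.structureAt_sq z.2 _
  · exact TwoSphere.complexStructure_sq z.2 _

/-- The chart `(x, 𝐚) ↦ L (x - l ε J x, l)` of the twistor space, where `l` is the stereographic
coordinate of `𝐚`. -/
noncomputable def twistorChart {ε : ℝ} (hε : ε ^ 2 = 1) {n : ℕ} (L : (E × ℂ) ≃L[ℝ] (Fin n → ℂ))
    (x₀ : FlatTorus Γ) : OpenPartialHomeomorph (FlatTorus Γ × TwoSphere) (Fin n → ℂ) :=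
  ((chartAt E x₀).prod (TwoSphere.stereoChart hε)).transHomeomorph
    ((h.shearHomeomorph hε).trans L.toHomeomorph)

variable {ε : ℝ} (hε : ε ^ 2 = 1) {n : ℕ} (L : (E × ℂ) ≃L[ℝ] (Fin n → ℂ)) (x₀ : FlatTorus Γ)

theorem twistorChart_apply (z : FlatTorus Γ × TwoSphere) :
    h.twistorChart Γ hε L x₀ z = L (h.shear ε (TwoSphere.stereo ε z.2) (chartAt E x₀ z.1),
      TwoSphere.stereo ε z.2) := rfl

theorem contMDiffAt_chartAt_stereo {z : FlatTorus Γ × TwoSphere}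
    (hz : z ∈ (h.twistorChart Γ hε L x₀).source) :
    ContMDiffAt (𝓘(ℝ, E).prod (𝓡 2)) 𝓘(ℝ, E × ℂ) ∞
      (fun z : FlatTorus Γ × TwoSphere => (chartAt E x₀ z.1, TwoSphere.stereo ε z.2)) z := by
  refine ContMDiffAt.prodMk_space ?_ ?_
  · exact ((contMDiffOn_chart (n := ∞)).contMDiffAt
      ((chartAt E x₀).open_source.mem_nhds hz.1)).comp z contMDiffAt_fst
  · exact (TwoSphere.contMDiffAt_stereo hz.2).comp z contMDiffAt_snd

theorem contMDiffAt_twistorChart {z : FlatTorus Γ × TwoSphere}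
    (hz : z ∈ (h.twistorChart Γ hε L x₀).source) :
    ContMDiffAt (𝓘(ℝ, E).prod (𝓡 2)) 𝓘(ℝ, Fin n → ℂ) ∞ (h.twistorChart Γ hε L x₀) z :=
  ContMDiffAt.comp z (g := fun q : E × ℂ => L (h.shear ε q.2 q.1, q.2))
    ((L.contDiff.comp ((h.contDiff_shear ε).prodMk contDiff_snd)).contMDiff.contMDiffAt)
    (h.contMDiffAt_chartAt_stereo Γ hε L x₀ hz)

theorem contMDiffOn_twistorChart_symm :
    ContMDiffOn 𝓘(ℝ, Fin n → ℂ) (𝓘(ℝ, E).prod (𝓡 2)) ∞ (h.twistorChart Γ hε L x₀).symm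
      (h.twistorChart Γ hε L x₀).target := by
  have hL : ContDiff ℝ ∞ (fun w : Fin n → ℂ => L.symm w) := L.symm.contDiff
  refine ContMDiffOn.prodMk ?_ ?_
  · exact (contMDiffOn_chart_symm (n := ∞) (x := x₀)).comp
      (((h.contDiff_shearInv ε).comp hL).contMDiff.contMDiffOn) fun w hw => hw.1
  · exact ((TwoSphere.contMDiff_stereoInv hε).comp
      (contDiff_snd.comp hL).contMDiff).contMDiffOn

theorem mvfderiv_twistorChart {z : FlatTorus Γ × TwoSphere}
    (hz : z ∈ (h.twistorChart Γ hε L x₀).source) (v : TangentSpace (𝓘(ℝ, E).prod (𝓡 2)) z) :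
    mvfderiv (𝓘(ℝ, E).prod (𝓡 2)) (h.twistorChart Γ hε L x₀) z v =
      L (h.shear ε (TwoSphere.stereo ε z.2) (v : E × EuclideanSpace ℝ (Fin 2)).1 +
        h.shearVar ε (mvfderiv (𝓡 2) (TwoSphere.stereo ε) z.2
          (v : E × EuclideanSpace ℝ (Fin 2)).2) (chartAt E x₀ z.1),
        mvfderiv (𝓡 2) (TwoSphere.stereo ε) z.2 (v : E × EuclideanSpace ℝ (Fin 2)).2) := by
  obtain ⟨A, hA, hA'⟩ := h.hasFDerivAt_shear ε (chartAt E x₀ z.1, TwoSphere.stereo ε z.2)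
  have h1 := (FlatTorus.hasMFDerivAt_chartAt Γ x₀ hz.1).comp z
    (hasMFDerivAt_fst (I := 𝓘(ℝ, E)) (I' := 𝓡 2) z)
  have h2 := (((TwoSphere.contMDiffAt_stereo hz.2).mdifferentiableAt (by simp)).hasMFDerivAt).comp z
    (hasMFDerivAt_snd (I := 𝓘(ℝ, E)) (I' := 𝓡 2) z)
  have h3 : HasMFDerivAt (𝓘(ℝ, E).prod (𝓡 2)) 𝓘(ℝ, E × ℂ)
      (fun z : FlatTorus Γ × TwoSphere => (chartAt E x₀ z.1, TwoSphere.stereo ε z.2)) z _ :=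
    ⟨h1.1.prodMk h2.1, h1.2.prodMk h2.2⟩
  have h4 := (L.hasFDerivAt.comp (chartAt E x₀ z.1, TwoSphere.stereo ε z.2) hA).hasMFDerivAt
  have h5 := HasMFDerivAt.comp z h4 h3
  have h6 := h5.mfderiv
  refine (congrArg (fun A => A v) h6).trans ?_
  exact congrArg L (hA' _)

variable (hL : ∀ w : E × ℂ, L (-(ε • h.I w.1), Complex.I * w.2) = Complex.I • L w)

-- The differential of the chart splits into a fibre part, complex linear by `shear_structureAt`,
-- and a part along the sphere, complex linear by `shearVar_I_mul` and the holomorphy of the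
-- stereographic coordinate.
include hL in
theorem isHolomorphicChart_twistorChart :
    IsHolomorphicChart (h.twistorStructure Γ) (h.twistorChart Γ hε L x₀) where
  contMDiffOn z hz := (h.contMDiffAt_twistorChart Γ hε L x₀ hz).contMDiffWithinAt
  contMDiffOn_symm := h.contMDiffOn_twistorChart_symm Γ hε L x₀
  complexLinear z hz v := by
    have hI := TwoSphere.mvfderiv_stereo_complexStructure hε hz.2
      (v : E × EuclideanSpace ℝ (Fin 2)).2
    rw [h.mvfderiv_twistorChart Γ hε L x₀ hz, h.mvfderiv_twistorChart Γ hε L x₀ hz, ← hL]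
    refine congrArg L (Prod.ext ?_ hI)
    simp only [map_add, smul_add, neg_add]
    exact congrArg₂ (· + ·) (h.shear_structureAt hε hz.2 _)
      ((congrArg (fun m => h.shearVar ε m (chartAt E x₀ z.1)) hI).trans (h.shearVar_I_mul hε _ _))

include hε in
theorem exists_linearEquiv_twistor [FiniteDimensional ℝ E] :
    ∃ (n : ℕ) (L : (E × ℂ) ≃L[ℝ] (Fin n → ℂ)),
      ∀ w : E × ℂ, L (-(ε • h.I w.1), Complex.I * w.2) = Complex.I • L w := by
  refine exists_continuousLinearEquiv_complex
    ((-(ε • h.I)).prodMap (Complex.I • ContinuousLinearMap.id ℝ ℂ)) fun w => ?_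
  refine Prod.ext ?_ ?_
  · change -(ε • h.I (-(ε • h.I w.1))) = -w.1
    rw [map_neg, map_smul, h.I_sq, smul_neg, smul_neg, smul_neg, smul_smul, ← pow_two, hε, one_smul,
      neg_neg]
  · change Complex.I * (Complex.I * w.2) = -w.2
    rw [← mul_assoc, Complex.I_mul_I, neg_one_mul]

theorem exists_sign (a : TwoSphere) : ∃ ε : ℝ, ε ^ 2 = 1 ∧ ε * a.1 0 ≠ 1 := by
  by_cases ha : a.1 0 = 1
  · exact ⟨-1, by norm_num, by rw [ha]; norm_num⟩
  · exact ⟨1, by norm_num, by rwa [one_mul]⟩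

theorem isComplexStructure_twistorStructure [FiniteDimensional ℝ E] :
    IsComplexStructure (h.twistorStructure Γ) := by
  refine ⟨h.twistorStructure_sq Γ, fun z => ?_⟩
  obtain ⟨ε, hε, hz⟩ := exists_sign z.2
  obtain ⟨n, L, hL⟩ := h.exists_linearEquiv_twistor hε
  exact ⟨n, h.twistorChart Γ hε L z.1, ⟨mem_chart_source E z.1, hz⟩,
    h.isHolomorphicChart_twistorChart Γ hε L z.1 hL⟩

/-! ### Vertical bivector fields on the twistor space -/

/-- The `(2,0)`-part of a constant bivector along the fibres `M × {𝐚}`. -/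
noncomputable def verticalBivector (R : CBivector E) (z : FlatTorus Γ × TwoSphere) :
    CBivector (TangentSpace (𝓘(ℝ, E).prod (𝓡 2)) z) :=
  CBivector.part20 (V := TangentSpace (𝓘(ℝ, E).prod (𝓡 2)) z) (h.twistorStructure Γ z)
    (R.pushforward (ContinuousLinearMap.inl ℝ E (EuclideanSpace ℝ (Fin 2))))

/-- The covector on `E` of type `(1,0)` with respect to `-εI` induced by a covector on `ℂⁿ`. -/
noncomputable def fibreCovector (α : (Fin n → ℂ) →L[ℝ] ℂ) : E →L[ℝ] ℂ :=
  (covector10 (complexI n) α).comp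
    ((L : (E × ℂ) →L[ℝ] (Fin n → ℂ)).comp (ContinuousLinearMap.inl ℝ E ℂ))

theorem complexI_sq (w : Fin n → ℂ) : complexI n (complexI n w) = -w := by
  change Complex.I • Complex.I • w = -w
  rw [smul_smul, Complex.I_mul_I, neg_one_smul]

include hL in
theorem fibreCovector_I (α : (Fin n → ℂ) →L[ℝ] ℂ) (v : E) :
    fibreCovector L α (-(ε • h.I v)) = Complex.I * fibreCovector L α v := by
  have h1 := hL (v, 0)
  rw [mul_zero] at h1
  change covector10 (complexI n) α (L (-(ε • h.I v), 0)) =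
    Complex.I * covector10 (complexI n) α (L (v, 0))
  rw [h1, ← covector10_apply_map complexI_sq]
  rfl

-- Taking $(1,0)$-parts commutes with pullback along a holomorphic chart, and on vertical vectors
-- the differential of the chart is the shear followed by `L`.
include hL in
theorem verticalBivector_apply (R : CBivector E) {z : FlatTorus Γ × TwoSphere}
    (hz : z ∈ (h.twistorChart Γ hε L x₀).source) (α β : (Fin n → ℂ) →L[ℝ] ℂ) :
    h.verticalBivector Γ R z
      ![α.comp (mvfderiv (𝓘(ℝ, E).prod (𝓡 2)) (h.twistorChart Γ hε L x₀) z),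
        β.comp (mvfderiv (𝓘(ℝ, E).prod (𝓡 2)) (h.twistorChart Γ hε L x₀) z)] =
      R ![(fibreCovector L α).comp (h.shear ε (TwoSphere.stereo ε z.2)),
        (fibreCovector L β).comp (h.shear ε (TwoSphere.stereo ε z.2))] := by
  have key : ∀ γ : (Fin n → ℂ) →L[ℝ] ℂ,
      (covector10 (V := TangentSpace (𝓘(ℝ, E).prod (𝓡 2)) z) (h.twistorStructure Γ z)
        (γ.comp (mvfderiv (𝓘(ℝ, E).prod (𝓡 2)) (h.twistorChart Γ hε L x₀) z))).comp
        (ContinuousLinearMap.inl ℝ E (EuclideanSpace ℝ (Fin 2))) =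
      (fibreCovector L γ).comp (h.shear ε (TwoSphere.stereo ε z.2)) := by
    intro γ
    rw [covector10_comp (J' := complexI n)
      ((h.isHolomorphicChart_twistorChart Γ hε L x₀ hL).complexLinear z hz)]
    ext v
    change covector10 (complexI n) γ (mvfderiv (𝓘(ℝ, E).prod (𝓡 2)) (h.twistorChart Γ hε L x₀) z
      ((v, 0) : E × EuclideanSpace ℝ (Fin 2))) =
        covector10 (complexI n) γ (L (h.shear ε (TwoSphere.stereo ε z.2) v, 0))
    refine congrArg (covector10 (complexI n) γ) ((h.mvfderiv_twistorChart Γ hε L x₀ hz _).trans ?_)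
    have h0 : mvfderiv (𝓡 2) (TwoSphere.stereo ε) z.2 (0 : EuclideanSpace ℝ (Fin 2)) = 0 :=
      map_zero (mvfderiv (𝓡 2) (TwoSphere.stereo ε) z.2)
    refine congrArg L (Prod.ext ?_ h0)
    refine (congrArg (fun m => h.shear ε (TwoSphere.stereo ε z.2) v +
      h.shearVar ε m (chartAt E x₀ z.1)) h0).trans ?_
    simp [shearVar]
  rw [verticalBivector, CBivector.part20_apply]
  refine (CBivector.pushforward_apply _ _ _ _).trans ?_
  rw [key, key]

/-- The constant bivector on `ℂⁿ` that represents `𝒫 / l` in a twistor chart. -/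
noncomputable def chartBivector [CompleteSpace E] (ε : ℝ) (L : (E × ℂ) ≃L[ℝ] (Fin n → ℂ)) :
    CBivector (Fin n → ℂ) :=
  ((-h.bivector.pushforward (h.shear ε (-1))).pushforward
    ((L : (E × ℂ) →L[ℝ] (Fin n → ℂ)).comp (ContinuousLinearMap.inl ℝ E ℂ))).part20 (complexI n)

theorem chartBivector_apply [CompleteSpace E] (α β : (Fin n → ℂ) →L[ℝ] ℂ) :
    h.chartBivector ε L ![α, β] = -h.bivector ![(fibreCovector L α).comp (h.shear ε (-1)),
      (fibreCovector L β).comp (h.shear ε (-1))] := by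
  rw [chartBivector, CBivector.part20_apply, CBivector.pushforward_apply, AlternatingMap.neg_apply,
    CBivector.pushforward_apply]
  rfl

/-- The last coordinate `l` of a twistor chart. -/
noncomputable def chartParam : (Fin n → ℂ) →L[ℝ] ℂ :=
  (ContinuousLinearMap.snd ℝ E ℂ).comp (L.symm : (Fin n → ℂ) →L[ℝ] E × ℂ)

include hL in
theorem chartParam_I_smul (w : Fin n → ℂ) :
    chartParam L (Complex.I • w) = Complex.I * chartParam L w := by
  obtain ⟨p, rfl⟩ := L.surjective w
  rw [← hL]
  simp [chartParam]

-- The coordinate $l$ is complex linear on $\mathbb C^n$, hence equal to its own $(1,0)$-part, and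
-- it vanishes along the fibre. This is what makes its powers Casimir functions.
include hL in
theorem fibreCovector_chartParam : fibreCovector L (chartParam L) = 0 := by
  ext v
  change covector10 (complexI n) (chartParam L) (L (v, 0)) = 0
  have h1 : complexI n (L (v, 0)) = Complex.I • L (v, 0) := rfl
  rw [covector10_apply, h1, h.chartParam_I_smul L hL]
  simp [chartParam]

include hL in
theorem differentiable_chartParam : Differentiable ℂ (chartParam L) := fun w =>
  differentiableAt_complex_of_fderiv_I_smul (chartParam L).differentiableAt fun v => by
    rw [ContinuousLinearMap.fderiv, h.chartParam_I_smul L hL]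

-- The exponent is left free because three values occur: `k = 1` for $\mathcal P$, and `k = 0` and
-- `k = 2` for its rescaling in the two charts.
include hL in
theorem isPoissonChart_twistorChart [CompleteSpace E]
    {Q : ∀ z : FlatTorus Γ × TwoSphere, CBivector (TangentSpace (𝓘(ℝ, E).prod (𝓡 2)) z)} (k : ℕ)
    (hQ : ∀ z ∈ (h.twistorChart Γ hε L x₀).source, ∀ α β : (Fin n → ℂ) →L[ℝ] ℂ,
      Q z ![α.comp (mvfderiv (𝓘(ℝ, E).prod (𝓡 2)) (h.twistorChart Γ hε L x₀) z),
        β.comp (mvfderiv (𝓘(ℝ, E).prod (𝓡 2)) (h.twistorChart Γ hε L x₀) z)] =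
      TwoSphere.stereo ε z.2 ^ k * h.chartBivector ε L ![α, β]) :
    IsPoissonChart (h.twistorStructure Γ) Q (h.twistorChart Γ hε L x₀)
      (fun w => chartParam L w ^ k) (h.chartBivector ε L) where
  toIsHolomorphicChart := h.isHolomorphicChart_twistorChart Γ hε L x₀ hL
  apply_comp z hz α β := by
    rw [hQ z hz, twistorChart_apply]
    simp [chartParam]
  differentiable := (h.differentiable_chartParam L hL).pow k
  contDiff := (chartParam L).contDiff.pow k
  casimir w α := by
    -- For `k = 0` the truncated exponent `k - 1` is harmless, as the factor `k` vanishes.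
    have h1 : fderiv ℝ (fun w => chartParam L w ^ k) w =
        (k * chartParam L w ^ (k - 1)) • chartParam L := by
      have := ((chartParam L).hasFDerivAt (x := w)).pow k
      rw [this.fderiv]
      ext v
      simp
    have h2 : fibreCovector L ((k * chartParam L w ^ (k - 1)) • chartParam L) = 0 := by
      have : fibreCovector L ((k * chartParam L w ^ (k - 1)) • chartParam L) =
          (k * chartParam L w ^ (k - 1)) • fibreCovector L (chartParam L) := by
        ext v
        simp [fibreCovector]
      rw [this, h.fibreCovector_chartParam L hL]
      ext v
      simp
    rw [h1, h.chartBivector_apply, h2, ContinuousLinearMap.zero_comp,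
      h.bivector.map_coord_zero 1 rfl, neg_zero]

variable [CompleteSpace E]

theorem twistorBivector_eq (z : FlatTorus Γ × TwoSphere) :
    h.twistorBivector Γ z = h.verticalBivector Γ h.bivector z := by
  rw [twistorBivector, mfderiv_prod_left]
  rfl

include hL in
theorem twistorBivector_apply {z : FlatTorus Γ × TwoSphere}
    (hz : z ∈ (h.twistorChart Γ hε L x₀).source) (α β : (Fin n → ℂ) →L[ℝ] ℂ) :
    h.twistorBivector Γ z
      ![α.comp (mvfderiv (𝓘(ℝ, E).prod (𝓡 2)) (h.twistorChart Γ hε L x₀) z),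
        β.comp (mvfderiv (𝓘(ℝ, E).prod (𝓡 2)) (h.twistorChart Γ hε L x₀) z)] =
      TwoSphere.stereo ε z.2 * h.chartBivector ε L ![α, β] := by
  rw [twistorBivector_eq, h.verticalBivector_apply Γ hε L x₀ hL _ hz,
    h.bivector_comp_shear hε _ (h.fibreCovector_I L hL α) (h.fibreCovector_I L hL β),
    chartBivector_apply]

theorem isHolomorphicPoisson_twistorBivector [FiniteDimensional ℝ E] :
    IsHolomorphicPoisson (h.twistorStructure Γ) (h.twistorBivector Γ) := by
  refine isHolomorphicPoisson_of_charts (fun z => ?_) fun z => ?_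
  · exact CBivector.part20_part20 (h.twistorStructure_sq Γ z) _
  · obtain ⟨ε, hε, hz⟩ := exists_sign z.2
    obtain ⟨n, L, hL⟩ := h.exists_linearEquiv_twistor hε
    refine ⟨n, h.twistorChart Γ hε L z.1, _, _, ⟨mem_chart_source E z.1, hz⟩,
      h.isPoissonChart_twistorChart Γ hε L z.1 hL 1 fun z' hz' α β => ?_⟩
    rw [h.twistorBivector_apply Γ hε L z.1 hL hz', pow_one]

/-! ### Extension of the rescaled bivector across the poles -/

theorem _root_.TwoSphere.stereo_mul_stereo_neg (hε : ε ^ 2 = 1) {a : TwoSphere}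
    (h₁ : ε * a.1 0 ≠ 1) (h₂ : ε * a.1 0 ≠ -1) :
    TwoSphere.stereo (-ε) a * TwoSphere.stereo ε a = 1 := by
  have hs := sphere_sq_add_sq a
  have e1 : ((1 - ε * a.1 0 : ℝ) : ℂ) ≠ 0 :=
    Complex.ofReal_ne_zero.2 fun e => h₁ (by linarith)
  have e2 : ((1 - -ε * a.1 0 : ℝ) : ℂ) ≠ 0 :=
    Complex.ofReal_ne_zero.2 fun e => h₂ (by linarith)
  rw [TwoSphere.stereo, TwoSphere.stereo, div_mul_div_comm, div_eq_one_iff_eq (mul_ne_zero e2 e1),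
    ← Complex.ofReal_mul]
  apply Complex.ext
  · simp only [Complex.mul_re, Complex.ofReal_re]
    linear_combination hs + (a.1 1 ^ 2 + a.1 0 ^ 2) * hε
  · simp only [Complex.mul_im, Complex.ofReal_im]
    ring

open Classical in
/-- The extension of `l⁻¹ 𝒫` to the twistor space, where `l` is the stereographic coordinate. -/
noncomputable def extendedBivector (ε : ℝ) (z : FlatTorus Γ × TwoSphere) :
    CBivector (TangentSpace (𝓘(ℝ, E).prod (𝓡 2)) z) :=
  -- Here $l=0$, and `stereo (-ε)` takes the default value of a division by zero, so the value must
  -- be prescribed: it is the one represented by `chartBivector` at $l=0$.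
  if ε * z.2.1 0 = -1 then
    h.verticalBivector Γ (-h.bivector.pushforward (h.shear ε (-1))) z
  else TwoSphere.stereo (-ε) z.2 • h.twistorBivector Γ z

theorem _root_.TwoSphere.stereo_eq_zero (hε : ε ^ 2 = 1) {a : TwoSphere} (ha : ε * a.1 0 = -1) :
    TwoSphere.stereo ε a = 0 := by
  have hs := sphere_sq_add_sq a
  have h0 : a.1 0 ^ 2 = 1 := by
    linear_combination (-a.1 0 ^ 2) * hε + (ε * a.1 0 - 1) * ha
  have h1 : a.1 1 = 0 := by nlinarith [sq_nonneg (a.1 1), sq_nonneg (a.1 2)]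
  have h2 : a.1 2 = 0 := by nlinarith [sq_nonneg (a.1 1), sq_nonneg (a.1 2)]
  rw [TwoSphere.stereo, h1, h2, mul_zero]
  exact zero_div _

/-- At $l=\infty$ the opposite chart, with $l'=1/l$, shows $l^{-1}\mathcal P=l'\cdot l'B'$. At all
other points the chart of `ε` shows the constant bivector $B$, including at $l=0$. -/
theorem isHolomorphicPoisson_extendedBivector [FiniteDimensional ℝ E] (hε : ε ^ 2 = 1) :
    IsHolomorphicPoisson (h.twistorStructure Γ) (h.extendedBivector Γ ε) := by
  refine isHolomorphicPoisson_of_charts (fun z => ?_) fun z => ?_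
  · rw [extendedBivector]
    split_ifs
    · exact CBivector.part20_part20 (h.twistorStructure_sq Γ z) _
    · rw [CBivector.part20_smul]
      congr 1
      exact CBivector.part20_part20 (h.twistorStructure_sq Γ z) _
  · have hε' : (-ε) ^ 2 = 1 := by rwa [neg_sq]
    by_cases hz : ε * z.2.1 0 = 1
    · have hz' : -ε * z.2.1 0 ≠ 1 := by rw [neg_mul, hz]; norm_num
      obtain ⟨n, L, hL⟩ := h.exists_linearEquiv_twistor hε'
      refine ⟨n, h.twistorChart Γ hε' L z.1, _, _, ⟨mem_chart_source E z.1, hz'⟩,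
        h.isPoissonChart_twistorChart Γ hε' L z.1 hL 2 fun y hy α β => ?_⟩
      -- The points with $l=0$ are exactly those missed by the projection with sign `-ε`, so only
      -- the generic branch occurs in this chart.
      have hy' : ¬ ε * y.2.1 0 = -1 := fun e => hy.2 (by rw [neg_mul, e, neg_neg])
      rw [extendedBivector, if_neg hy', AlternatingMap.smul_apply,
        h.twistorBivector_apply Γ hε' L z.1 hL hy, smul_eq_mul]
      ring
    · obtain ⟨n, L, hL⟩ := h.exists_linearEquiv_twistor hε
      refine ⟨n, h.twistorChart Γ hε L z.1, _, _, ⟨mem_chart_source E z.1, hz⟩,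
        h.isPoissonChart_twistorChart Γ hε L z.1 hL 0 fun y hy α β => ?_⟩
      rw [pow_zero, one_mul, extendedBivector]
      split_ifs with hy'
      -- At $l=0$ the shear is the identity, so the prescribed value agrees with the constant
      -- `chartBivector`.
      · rw [h.verticalBivector_apply Γ hε L z.1 hL _ hy, TwoSphere.stereo_eq_zero hε hy', shear_zero,
          chartBivector_apply, AlternatingMap.neg_apply, CBivector.pushforward_apply]
        rfl
      · rw [AlternatingMap.smul_apply, h.twistorBivector_apply Γ hε L z.1 hL hy, smul_eq_mul,
          ← mul_assoc, TwoSphere.stereo_mul_stereo_neg hε hy.2 hy', one_mul]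

end LinearHyperkahler

theorem TwoSphere.stereo_one (a : TwoSphere) : stereo 1 a = lam a := by
  rw [stereo, lam, one_mul, one_mul]

theorem TwoSphere.stereo_neg_one (a : TwoSphere) : stereo (-1) a = lamInv a := by
  rw [stereo, lamInv, neg_one_mul, neg_one_mul, sub_neg_eq_add]

theorem theorem4p1 {E : Type*} [NormedAddCommGroup E] [InnerProductSpace ℝ E]
    [FiniteDimensional ℝ E] (h : LinearHyperkahler E)
    (Γ : Submodule ℤ E) [DiscreteTopology Γ] [IsZLattice ℝ Γ] :
    IsComplexStructure (h.twistorStructure Γ) ∧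
    IsHolomorphicPoisson (h.twistorStructure Γ) (h.twistorBivector Γ) ∧
    (∃ Q : ∀ z : FlatTorus Γ × TwoSphere, CBivector (TangentSpace (𝓘(ℝ, E).prod (𝓡 2)) z),
      IsHolomorphicPoisson (h.twistorStructure Γ) Q ∧
      ∀ z : FlatTorus Γ × TwoSphere, z.2.1 0 ≠ -1 →
        Q z = TwoSphere.lamInv z.2 • h.twistorBivector Γ z) ∧
    (∃ Q : ∀ z : FlatTorus Γ × TwoSphere, CBivector (TangentSpace (𝓘(ℝ, E).prod (𝓡 2)) z),
      IsHolomorphicPoisson (h.twistorStructure Γ) Q ∧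
      ∀ z : FlatTorus Γ × TwoSphere, z.2.1 0 ≠ 1 →
        Q z = TwoSphere.lam z.2 • h.twistorBivector Γ z) := by
  refine ⟨h.isComplexStructure_twistorStructure Γ, h.isHolomorphicPoisson_twistorBivector Γ,
    ⟨h.extendedBivector Γ 1, h.isHolomorphicPoisson_extendedBivector Γ (by norm_num),
      fun z hz => ?_⟩,
    ⟨h.extendedBivector Γ (-1), h.isHolomorphicPoisson_extendedBivector Γ (by norm_num),
      fun z hz => ?_⟩⟩
  · rw [LinearHyperkahler.extendedBivector, if_neg (by rwa [one_mul]), TwoSphere.stereo_neg_one]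
  · rw [LinearHyperkahler.extendedBivector, if_neg (by rwa [neg_one_mul, neg_inj]), neg_neg,
      TwoSphere.stereo_one]
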